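/- The reduced power graph $P^*(G)$ of a group $G$ is the simple graph whose vertices are the non-identity elements of $G$, two distinct vertices $u,v$ being adjacent if and only if $u=v^i$ or $v=u^j$ for some positive integers $i,j$. A graph is claw-free if it has no induced subgraph isomorphic to $K_{1,3}$. For a finite group $G$ let $\pi(G)$ denote the number of distinct prime divisors of $|G|$. **Theorem.** Let $G$ be a finite solvable group. If $P^*(G)$ is claw-free, then $\pi(G)\le 4$. The bound is best possible. The cyclic groups $\langle x_1\rangle\cong C_{31}$ and $\langle x_2\rangle\cong C_{61}$ have automorphisms of order $15$. Let $\alpha_1\in\operatorname{Aut}\langle x_1\rangle$ and $\alpha_2\in\operatorname{Aut}\langle x_2\rangle$ be any automorphisms of order $15$, and let $\langle y\rangle\cong C_{15}$. Then there is a semidirect product $G=(\langle x_1\rangle\times\langle x_2\rangle)\rtimes\langle y\rangle\cong C_{31\cdot 61}\rtimes C_{15}$ in which $y$ acts on $\langle x_1\rangle\times\langle x_2\rangle$ (a cyclic group of order $31\cdot 61$) as $\alpha_1\times\alpha_2$, and $G$ is a finite solvable group with $P^*(G)$ claw-free and $\pi(G)=4$. -/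

import Mathlib

/-- The undirected power graph of a group: distinct `u`, `v` are joined by an edge iff one of them
is a positive power of the other. -/
def powerGraph (G : Type*) [Group G] : SimpleGraph G where
  Adj u v := u ≠ v ∧ ((∃ i : ℕ, 0 < i ∧ u = v ^ i) ∨ ∃ j : ℕ, 0 < j ∧ v = u ^ j)
  symm := ⟨fun _ _ h => ⟨h.1.symm, h.2.symm⟩⟩
  loopless := ⟨fun _ h => h.1 rfl⟩

/-- The reduced power graph: the subgraph of the power graph induced on the non-identity
elements. -/
def reducedPowerGraph (G : Type*) [Group G] : SimpleGraph {g : G | g ≠ 1} :=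
  (powerGraph G).induce {g : G | g ≠ 1}

/-- A graph is claw-free if it has no induced subgraph isomorphic to `K_{1,3}`. -/
def ClawFree {V : Type*} (Γ : SimpleGraph V) : Prop :=
  ¬ (completeBipartiteGraph (Fin 1) (Fin 3)).IsIndContained Γ

/-- The number of distinct prime divisors of the order of a (finite) group. -/
noncomputable def numPrimeDivisors (G : Type*) [Group G] : ℕ :=
  (Nat.card G).primeFactors.card

/-- The cyclic group of order `n`, written multiplicatively. -/
abbrev Cyc (n : ℕ) : Type := Multiplicative (ZMod n)

/-! Claw-freeness enters through three local facts. Commuting elements a, b, c of distinct prime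
orders give a claw centred at abc (`ClawFree.not_three_orders`). If elements of three distinct prime
orders commute with z, whose prime order differs from all three, their products with z form a claw
centred at z (`ClawFree.not_three_neighbors`). An element of prime order centralizes no noncyclic
elementary abelian q-group for another prime q (`ClawFree.mem_zpowers_of_commute`).

Suppose |G| has five prime divisors. Take a normal elementary abelian p-subgroup N, a p-complement
K, a K-invariant elementary abelian q-subgroup Q of K, and a q-complement J of K, whose order keeps
three primes. If K is not faithful on N, choose Q centralizing N. Then N and Q have prime order,
commutators in J centralize both, and J is forced to be abelian, which is impossible with three
primes. If K is faithful on N, averaging over group actions produces fixed points in N. Whether J is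
faithful on Q (`ClawFree.false_of_faithful_tower`) or not (`ClawFree.false_of_commuting_pair`),
these fixed points commute with elements of too many other prime orders.

For sharpness, the action in the example is fixed-point-free, so every nontrivial centralizer embeds
in a cyclic group of order 31·61 or 3·5, which leaves no room for a claw. -/

/-! ### Fixed points of group actions by averaging. -/

section Averaging

variable {G V : Type*} [Group G] [CommGroup V] (ρ : G →* MulAut V)

lemma map_prod_pow_orbit (w : G) {m : ℕ} (hm : w ^ m = 1) (v : V) :
    ρ w (∏ i ∈ Finset.range m, ρ (w ^ i) v) = ∏ i ∈ Finset.range m, ρ (w ^ i) v := by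
  rw [map_prod]
  have h1 : ∀ i, ρ w (ρ (w ^ i) v) = ρ (w ^ (i + 1)) v := fun i => by
    rw [pow_succ', map_mul, MulAut.mul_apply]
  simp only [h1]
  have h2 := Finset.prod_range_succ (fun i => ρ (w ^ i) v) m
  rw [Finset.prod_range_succ', hm, pow_zero] at h2
  exact mul_right_cancel h2

/-- A semiregular cyclic group acting on `Y` has a fixed point wherever `Y` acts nontrivially. -/
lemma trivial_action_of_fixedPointFree (Y : Subgroup G) [Finite Y] (w : G) (hw : IsOfFinOrder w)
    (hnorm : ∀ y ∈ Y, w * y * w⁻¹ ∈ Y)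
    (hfree : ∀ i : ℕ, w ^ i ≠ 1 → ∀ y ∈ Y, w ^ i * y = y * w ^ i → y = 1)
    (htors : ∀ v : V, v ^ Nat.card Y = 1 → v = 1)
    (hfix : ∀ v, ρ w v = v → v = 1) (v : V) {y : G} (hy : y ∈ Y) : ρ y v = v := by
  classical
  have := Fintype.ofFinite Y
  set m := orderOf w with hm
  have hnormi : ∀ i : ℕ, ∀ y ∈ Y, w ^ i * y * (w ^ i)⁻¹ ∈ Y := by
    intro i
    induction i with
    | zero => simp
    | succ k ih =>
      intro y hy
      have := hnorm _ (ih y hy)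
      rw [pow_succ']
      simpa [mul_assoc] using this
  -- Each conjugate of w by an element of Y also has only trivial fixed points, so its orbit
  -- products are trivial.
  have hsum : ∏ i ∈ Finset.range m, ∏ y : Y, ρ (y * w ^ i * (y : G)⁻¹) v = 1 := by
    rw [Finset.prod_comm]
    refine Finset.prod_eq_one fun y _ => ?_
    have : ∏ i ∈ Finset.range m, ρ (w ^ i) (ρ (y : G)⁻¹ v) = 1 :=
      hfix _ (map_prod_pow_orbit ρ w (pow_orderOf_eq_one w) _)
    have h2 := congrArg (ρ (y : G)) this
    rw [map_prod, map_one] at h2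
    simpa [MulAut.mul_apply, map_mul] using h2
  have hinv : ∀ u : V, ∀ y ∈ Y, ρ y (∏ x : Y, ρ (x : G) u) = ∏ x : Y, ρ (x : G) u := by
    intro u y hy
    rw [map_prod]
    refine Fintype.prod_equiv (Equiv.mulLeft (⟨y, hy⟩ : Y)) _ _ fun x => ?_
    simp [MulAut.mul_apply]
  obtain ⟨k, hk⟩ : ∃ k, m = k + 1 := Nat.exists_eq_succ_of_ne_zero hw.orderOf_pos.ne'
  -- For a nontrivial power u of w, the map y ↦ y(uy⁻¹u⁻¹) permutes Y by semiregularity, so the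
  -- conjugates of u sweep out the coset Yu.
  have hterm : ∀ i ∈ Finset.range k, ∏ y : Y, ρ (y * w ^ (i + 1) * (y : G)⁻¹) v =
      ∏ x : Y, ρ (x : G) (ρ (w ^ (i + 1)) v) := by
    intro i hi
    have hne : w ^ (i + 1) ≠ 1 := by
      intro h
      have := Nat.le_of_dvd (Nat.succ_pos _) (orderOf_dvd_of_pow_eq_one h)
      have := Finset.mem_range.1 hi
      omega
    let f : Y → Y := fun y => y * ⟨w ^ (i + 1) * (y : G)⁻¹ * (w ^ (i + 1))⁻¹,
      hnormi _ _ (inv_mem y.2)⟩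
    have hf : Function.Injective f := by
      intro y₁ y₂ h
      have h' : (y₁ : G) * (w ^ (i + 1) * (y₁ : G)⁻¹ * (w ^ (i + 1))⁻¹) =
        y₂ * (w ^ (i + 1) * (y₂ : G)⁻¹ * (w ^ (i + 1))⁻¹) := congrArg Subtype.val h
      have h3 : w ^ (i + 1) * ((y₁ : G)⁻¹ * y₂) = ((y₁ : G)⁻¹ * y₂) * w ^ (i + 1) := by
        have h4 : (y₁ : G) * w ^ (i + 1) * (y₁ : G)⁻¹ = y₂ * w ^ (i + 1) * (y₂ : G)⁻¹ := by
          simpa [← mul_assoc] using h'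
        calc w ^ (i + 1) * ((y₁ : G)⁻¹ * y₂)
            = (y₁ : G)⁻¹ * ((y₁ : G) * w ^ (i + 1) * (y₁ : G)⁻¹) * y₂ := by group
          _ = _ := by rw [h4]; group
      have h5 := hfree _ hne _ (mul_mem (inv_mem y₁.2) y₂.2) h3
      exact Subtype.ext (inv_mul_eq_one.1 h5)
    refine Fintype.prod_bijective f (Finite.injective_iff_bijective.1 hf) _ _ fun y => ?_
    rw [← MulAut.mul_apply, ← map_mul]
    congr 2
    simp [f, mul_assoc]
  -- The exponent 0 contributes v ^ |Y|; everything else is Y-invariant, hence so is v ^ |Y|.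
  rw [hk, Finset.prod_range_succ', Finset.prod_congr rfl hterm] at hsum
  set T := ∏ i ∈ Finset.range k, ∏ x : Y, ρ (x : G) (ρ (w ^ (i + 1)) v)
  have hT : ρ y T = T := by
    rw [map_prod]
    exact Finset.prod_congr rfl fun i _ => hinv _ y hy
  have hcard : T * v ^ Nat.card Y = 1 := by
    simpa [Nat.card_eq_fintype_card] using hsum
  have hv : ρ y (v ^ Nat.card Y) = v ^ Nat.card Y := by
    rw [eq_inv_of_mul_eq_one_right hcard, map_inv, hT]
  have := htors (ρ y v / v) (by rw [div_pow, ← map_pow, hv, div_self'])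
  exact div_eq_one.1 this

/-- A noncyclic group of order `q ^ 2` acting on an abelian group without `q`-torsion has an
element with a nontrivial fixed point. -/
lemma exists_fixedPoint_of_commute {q : ℕ} (hq : q.Prime) {a b : G} (hab : Commute a b)
    (ha : a ^ q = 1) (hb : b ^ q = 1) (V₀ : Subgroup V)
    (hVa : ∀ v ∈ V₀, ρ a v ∈ V₀) (hVb : ∀ v ∈ V₀, ρ b v ∈ V₀)
    (htors : ∀ v : V, v ^ q = 1 → v = 1) {v : V} (hv : v ∈ V₀) (hv1 : v ≠ 1) :
    ∃ z : G, (z = b ∨ ∃ i : ℕ, z = a * b ^ i) ∧ ∃ u ∈ V₀, u ≠ 1 ∧ ρ z u = u := by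
  by_contra hcon
  push Not at hcon
  have hfa : ∀ i : ℕ, ∀ u ∈ V₀, ρ (a * b ^ i) u = u → u = 1 := fun i u hu h =>
    by_contra fun h1 => hcon _ (Or.inr ⟨i, rfl⟩) u hu h1 h
  have hfb : ∀ u ∈ V₀, ρ b u = u → u = 1 := fun u hu h =>
    by_contra fun h1 => hcon _ (Or.inl rfl) u hu h1 h
  have hpow : ∀ g : G, (∀ v ∈ V₀, ρ g v ∈ V₀) → ∀ n : ℕ, ∀ v ∈ V₀, ρ (g ^ n) v ∈ V₀ := by
    intro g hg n
    induction n with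
    | zero => simp
    | succ k ih =>
      intro v hv
      rw [pow_succ, map_mul, MulAut.mul_apply]
      exact ih _ (hg v hv)
  have hmul : ∀ i : ℕ, ∀ v ∈ V₀, ρ (a * b ^ i) v ∈ V₀ := fun i v hv => by
    rw [map_mul, MulAut.mul_apply]
    exact hVa _ (hpow b hVb i v hv)
  have h1 : ∏ i ∈ Finset.range q, ∏ j ∈ Finset.range q, ρ ((a * b ^ i) ^ j) v = 1 := by
    refine Finset.prod_eq_one fun i _ => hfa i _ ?_ ?_
    · exact V₀.prod_mem fun j _ => hpow _ (hmul i) j v hv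
    · refine map_prod_pow_orbit ρ _ ?_ v
      rw [(hab.pow_right i).mul_pow, ha, ← pow_mul, mul_comm, pow_mul, hb, one_pow, one_mul]
  obtain ⟨k, hk⟩ : ∃ k, q = k + 1 := Nat.exists_eq_succ_of_ne_zero hq.ne_zero
  -- For a fixed nonzero exponent, the product over i is, up to a power of a, an orbit product of b
  -- ^ (j + 1). It is fixed by b, a power of b ^ (j + 1), hence trivial. Only exponent 0 survives,
  -- giving v ^ q.
  have h2 : ∀ j ∈ Finset.range k, ∏ i ∈ Finset.range q, ρ ((a * b ^ i) ^ (j + 1)) v = 1 := by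
    intro j hj
    have hj' := Finset.mem_range.1 hj
    have h3 : ∀ i : ℕ, ρ ((a * b ^ i) ^ (j + 1)) v =
        ρ (a ^ (j + 1)) (ρ ((b ^ (j + 1)) ^ i) v) := fun i => by
      rw [(hab.pow_right i).mul_pow, map_mul, MulAut.mul_apply, ← pow_mul, ← pow_mul, mul_comm i]
    simp only [h3]
    rw [← map_prod]
    have h4 : ∏ i ∈ Finset.range q, ρ ((b ^ (j + 1)) ^ i) v = 1 := by
      refine hfb _ (V₀.prod_mem fun i _ => hpow _ (hpow b hVb _) i v hv) ?_
      have hfix := map_prod_pow_orbit ρ (b ^ (j + 1)) (m := q)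
        (by rw [← pow_mul, mul_comm, pow_mul, hb, one_pow]) v
      set u := ∏ i ∈ Finset.range q, ρ ((b ^ (j + 1)) ^ i) v
      obtain ⟨n, hn⟩ : ∃ n : ℕ, b = (b ^ (j + 1)) ^ n := by
        have hcop : (j + 1).Coprime q := by
          refine ((Nat.Prime.coprime_iff_not_dvd hq).2 fun h => ?_).symm
          have := Nat.le_of_dvd (Nat.succ_pos _) h
          omega
        obtain ⟨n, -, hn⟩ := Nat.exists_mul_mod_eq_one_of_coprime hcop hq.one_lt
        refine ⟨n, ?_⟩
        rw [← pow_mul, ← Nat.mod_add_div ((j + 1) * n) q, hn, pow_add, pow_mul, hb, one_pow,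
          mul_one, pow_one]
      rw [hn]
      generalize n = n
      induction n with
      | zero => simp
      | succ n ih => rw [pow_succ, map_mul, MulAut.mul_apply, hfix, ih]
    rw [h4, map_one]
  rw [Finset.prod_comm] at h1
  nth_rw 1 [hk] at h1
  rw [Finset.prod_range_succ', Finset.prod_congr rfl h2] at h1
  exact hv1 (htors v (by simpa using h1))

end Averaging

/-! ### Membership in cyclic subgroups. -/

/-- Raising x to the power `orderOf z` kills the contribution of z but, by coprimality, does not
change the subgroup generated by x. -/
lemma Commute.mem_zpowers_of_mem_zpowers_mul {G : Type*} [Group G] {x y z : G} (hzy : Commute z y)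
    (hx : x ∈ Subgroup.zpowers (z * y)) (hcop : (orderOf z).Coprime (orderOf x)) :
    x ∈ Subgroup.zpowers y := by
  obtain ⟨k, rfl⟩ := hx
  have h1 : ((z * y) ^ k) ^ orderOf z ∈ Subgroup.zpowers y := by
    refine ⟨k * orderOf z, ?_⟩
    simp only
    rw [← zpow_natCast, ← zpow_mul, hzy.mul_zpow, mul_comm k, zpow_mul z, zpow_natCast,
      pow_orderOf_eq_one, one_zpow, one_mul]
  have h2 : (z * y) ^ k ∈ Subgroup.zpowers (((z * y) ^ k) ^ orderOf z) :=
    mem_zpowers_pow_iff.2 (Nat.coprime_comm.1 hcop).symm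
  exact (Subgroup.zpowers_le.2 h1) h2

lemma mem_zpowers_swap {G : Type*} [Group G] {q : ℕ} (hq : q.Prime) {x y : G} (hy : y ^ q = 1)
    (hx1 : x ≠ 1) (hx : x ∈ Subgroup.zpowers y) : y ∈ Subgroup.zpowers x := by
  have := Fact.mk hq
  have hy1 : y ≠ 1 := by
    rintro rfl
    simp at hx
    exact hx1 hx
  have hoy : orderOf y = q := orderOf_eq_prime hy hy1
  obtain ⟨k, rfl⟩ := hx
  refine mem_zpowers_zpow_iff.2 ?_
  rw [hoy, Int.gcd_comm]
  refine (Nat.Prime.coprime_iff_not_dvd hq).2 fun h => hx1 ?_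
  simp only
  rw [← orderOf_dvd_iff_zpow_eq_one, hoy]
  exact Int.natCast_dvd.2 h

/-! ### Fixed points when the fixed-point groups are lines. -/

section LinesAction

variable {G V : Type*} [Group G] [CommGroup V] (ρ : G →* MulAut V)

/-- A group acting faithfully on a noncyclic elementary abelian group `Q`, which itself acts
faithfully with fixed-point groups that are lines, has nontrivial fixed points elementwise. -/
lemma exists_fixedPoint_of_lines {q : ℕ} (hq : q.Prime) (Q J : Subgroup G)
    (hnorm : ∀ l ∈ J, ∀ x ∈ Q, l * x * l⁻¹ ∈ Q)
    (hcomm : ∀ x ∈ Q, ∀ y ∈ Q, Commute x y) (hexp : ∀ x ∈ Q, x ^ q = 1)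
    (hJ : ∀ l ∈ J, (∀ x ∈ Q, Commute l x) → l = 1)
    (hfaith : ∀ x ∈ Q, (∀ v, ρ x v = v) → x = 1)
    (htors : ∀ v : V, v ^ q = 1 → v = 1)
    (hstab : ∀ v : V, v ≠ 1 → ∀ x ∈ Q, ∀ y ∈ Q, x ≠ 1 → ρ x v = v → ρ y v = v →
      y ∈ Subgroup.zpowers x)
    (hline : ∀ x ∈ Q, x ≠ 1 → ∀ v w : V, v ≠ 1 → ρ x v = v → ρ x w = w →
      w ∈ Subgroup.zpowers v)
    (hQ : ∃ a ∈ Q, ∃ b ∈ Q, a ≠ 1 ∧ b ∉ Subgroup.zpowers a)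
    {l : G} (hl : l ∈ J) (hlfin : IsOfFinOrder l) : ∃ v : V, v ≠ 1 ∧ ρ l v = v := by
  obtain ⟨a, haQ, b, hbQ, ha1, hba⟩ := hQ
  have hb1 : b ≠ 1 := fun h => hba (h ▸ one_mem _)
  have zfix : ∀ (x : G) (v : V), ρ x v = v → ∀ y ∈ Subgroup.zpowers x, ρ y v = v := by
    rintro x v hx _ ⟨n, rfl⟩
    have : x ∈ (MulAction.stabilizer (MulAut V) v).comap ρ := hx
    exact zpow_mem this n
  have fixed : ∀ V₀ : Subgroup V, (∀ x ∈ Q, ∀ v ∈ V₀, ρ x v ∈ V₀) → ∀ v ∈ V₀, v ≠ 1 →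
      ∃ z ∈ Q, z ≠ 1 ∧ ∃ u ∈ V₀, u ≠ 1 ∧ ρ z u = u := by
    intro V₀ hV₀ v hv hv1
    obtain ⟨z, hz, u, hu, hu1, hzu⟩ := exists_fixedPoint_of_commute ρ hq (hcomm a haQ b hbQ)
      (hexp a haQ) (hexp b hbQ) V₀ (hV₀ a haQ) (hV₀ b hbQ) htors hv hv1
    have hz' : z ∈ Q ∧ z ≠ 1 := by
      rcases hz with rfl | ⟨i, rfl⟩
      · exact ⟨hbQ, hb1⟩
      · refine ⟨mul_mem haQ (pow_mem hbQ i), fun h => hba ?_⟩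
        refine mem_zpowers_swap hq (hexp b hbQ) ha1 ?_
        rw [mul_eq_one_iff_eq_inv.1 h]
        exact inv_mem (Subgroup.npow_mem_zpowers b i)
    exact ⟨z, hz'.1, hz'.2, u, hu, hu1, hzu⟩
  obtain ⟨v₀, hv₀⟩ : ∃ v, ρ a v ≠ v := by
    by_contra h
    push Not at h
    exact ha1 (hfaith a haQ h)
  obtain ⟨z₁, hz₁Q, hz₁1, v₁, -, hv₁1, hv₁⟩ := fixed ⊤ (fun _ _ _ _ => trivial) v₀ trivial
    (by rintro rfl; exact hv₀ (map_one _))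
  obtain ⟨d, hd⟩ : ∃ v, ρ z₁ v ≠ v := by
    by_contra h
    push Not at h
    exact hz₁1 (hfaith z₁ hz₁Q h)
  -- The norm map of z: its values on V are fixed by z when z ∈ Q, and it is the q-th power on fixed
  -- points of z.
  let N : G → V →* V := fun z => ∏ i ∈ Finset.range q, (ρ (z ^ i)).toMonoidHom
  have hN : ∀ z v, N z v = ∏ i ∈ Finset.range q, ρ (z ^ i) v := fun z v => by
    simp [N, MonoidHom.finsetProd_apply]
  have hNfix : ∀ z v, ρ z v = v → N z v = v ^ q := fun z v h => by
    rw [hN, Finset.prod_congr rfl fun i _ => zfix z v h _ (Subgroup.npow_mem_zpowers z i)]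
    simp
  have hNinv : ∀ z ∈ Q, ∀ v, ρ z (N z v) = N z v := fun z hz v => by
    rw [hN]
    exact map_prod_pow_orbit ρ z (hexp z hz) v
  have hNcomm : ∀ z x : G, Commute z x → ∀ v, N z (ρ x v) = ρ x (N z v) := fun z x h v => by
    rw [hN, hN, map_prod]
    refine Finset.prod_congr rfl fun i _ => ?_
    rw [← MulAut.mul_apply, ← MulAut.mul_apply, ← map_mul, ← map_mul, (h.pow_left i).eq]
  -- The kernel of `N z₁` is Q-invariant and contains the nontrivial `ρ z₁ d / d`. On it z₁ has no
  -- nontrivial fixed point, so a z₂ with a fixed point there generates a different subgroup.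
  obtain ⟨z₂, hz₂Q, hz₂1, v₂, hv₂N, hv₂1, hv₂⟩ := fixed (N z₁).ker
    (fun x hx v hv => by
      rw [MonoidHom.mem_ker] at hv ⊢
      rw [hNcomm z₁ x (hcomm _ hz₁Q _ hx), hv, map_one])
    (ρ z₁ d / d)
    (by rw [MonoidHom.mem_ker, map_div, hNcomm z₁ z₁ (Commute.refl _), hNinv z₁ hz₁Q, div_self'])
    (fun h => hd (div_eq_one.1 h))
  have hz₂₁ : z₂ ∉ Subgroup.zpowers z₁ := by
    intro h
    have h1 := zfix _ _ hv₂ _ (mem_zpowers_swap hq (hexp z₁ hz₁Q) hz₂1 h)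
    exact hv₂1 (htors _ ((hNfix _ _ h1).symm.trans hv₂N))
  -- Both g and x preserve the line fixed by z and act on it by power maps, so they commute there.
  -- Their commutator therefore fixes a nontrivial point also fixed by z.
  have key : ∀ g ∈ J, ∀ z ∈ Q, z ≠ 1 → ∀ v : V, v ≠ 1 → ρ z v = v →
      g * z * g⁻¹ ∈ Subgroup.zpowers z → ∀ x ∈ Q, g * x * g⁻¹ * x⁻¹ ∈ Subgroup.zpowers z := by
    intro g hg z hz hz1 v hv1 hv hgz x hx
    have hgz1 : g * z * g⁻¹ ≠ 1 := fun h => hz1 (by simpa using h)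
    have h1 : ρ z (ρ g v) = ρ g v := by
      refine zfix _ _ ?_ _ (mem_zpowers_swap hq (hexp z hz) hgz1 hgz)
      rw [← MulAut.mul_apply, ← map_mul]
      simp only [inv_mul_cancel_right]
      rw [map_mul, MulAut.mul_apply, hv]
    have h2 : ρ z (ρ x v) = ρ x v := by
      rw [← MulAut.mul_apply, ← map_mul, (hcomm z hz x hx).eq, map_mul, MulAut.mul_apply, hv]
    obtain ⟨m, hm⟩ := hline z hz hz1 v _ hv1 hv h1
    obtain ⟨n, hn⟩ := hline z hz hz1 v _ hv1 hv h2
    simp only at hm hn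
    have h3 : ρ (g * x) v = ρ (x * g) v := by
      rw [map_mul, map_mul, MulAut.mul_apply, MulAut.mul_apply, ← hm, ← hn, map_zpow, map_zpow,
        ← hm, ← hn, ← zpow_mul, ← zpow_mul, mul_comm]
    refine hstab (ρ (x * g) v) (by simpa using hv1) z hz _
      (mul_mem (hnorm g hg x hx) (inv_mem hx)) hz1 ?_ ?_
    · rw [map_mul, MulAut.mul_apply, ← hm, map_zpow, ← hn, map_zpow, map_zpow, hv]
    · rw [← MulAut.mul_apply, ← map_mul, ← h3]
      congr 2
      group
  -- Commutators of g with Q lie in two distinct subgroups of order q, so they vanish and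
  -- faithfulness gives g = 1.
  have key2 : ∀ g ∈ J, ∀ z ∈ Q, z ≠ 1 → ∀ v : V, v ≠ 1 → ρ z v = v →
      ∀ z' ∈ Q, z' ≠ 1 → ∀ v' : V, v' ≠ 1 → ρ z' v' = v' → z' ∉ Subgroup.zpowers z →
      g * z * g⁻¹ ∈ Subgroup.zpowers z → g * z' * g⁻¹ ∈ Subgroup.zpowers z' → g = 1 := by
    intro g hg z hz hz1 v hv1 hv z' hz' hz'1 v' hv'1 hv' hne h h'
    refine hJ g hg fun x hx => ?_
    have h1 := key g hg z hz hz1 v hv1 hv h x hx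
    have h2 := key g hg z' hz' hz'1 v' hv'1 hv' h' x hx
    by_contra hcon
    have h3 : g * x * g⁻¹ * x⁻¹ ≠ 1 := by
      intro h3
      apply hcon
      have := mul_inv_eq_one.1 h3
      exact mul_inv_eq_iff_eq_mul.1 this
    exact hne ((Subgroup.zpowers_le.2 h1) (mem_zpowers_swap hq (hexp z' hz') h3 h2))
  -- If l normalizes ⟨z₁⟩, use z₂. Otherwise use z₁: a power of l normalizing ⟨z₁⟩ also normalizes
  -- its conjugate under l, a different subgroup.
  obtain ⟨z, hz, hz1, v, hv1, hv, hlz⟩ : ∃ z ∈ Q, z ≠ 1 ∧ ∃ v : V, v ≠ 1 ∧ ρ z v = v ∧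
      ∀ i : ℕ, l ^ i * z * (l ^ i)⁻¹ ∈ Subgroup.zpowers z → l ^ i = 1 := by
    by_cases hlz₁ : l * z₁ * l⁻¹ ∈ Subgroup.zpowers z₁
    · refine ⟨z₂, hz₂Q, hz₂1, v₂, hv₂1, hv₂, fun i hi => ?_⟩
      refine key2 _ (pow_mem hl i) z₁ hz₁Q hz₁1 v₁ hv₁1 hv₁ z₂ hz₂Q hz₂1 v₂ hv₂1 hv₂ hz₂₁ ?_ hi
      have hle : ∀ x ∈ Subgroup.zpowers z₁, l * x * l⁻¹ ∈ Subgroup.zpowers z₁ := by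
        rintro _ ⟨n, rfl⟩
        simp only
        rw [← conj_zpow]
        exact zpow_mem hlz₁ n
      clear hi
      induction i with
      | zero => simp
      | succ k ih =>
        have := hle _ ih
        rw [pow_succ']
        simpa [mul_assoc] using this
    · refine ⟨z₁, hz₁Q, hz₁1, v₁, hv₁1, hv₁, fun i hi => ?_⟩
      refine key2 _ (pow_mem hl i) z₁ hz₁Q hz₁1 v₁ hv₁1 hv₁ (l * z₁ * l⁻¹) (hnorm l hl _ hz₁Q)
        (fun h => hz₁1 (by simpa using h)) (ρ l v₁) (by simpa using hv₁1) ?_ hlz₁ hi ?_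
      · rw [← MulAut.mul_apply, ← map_mul]
        simp only [inv_mul_cancel_right]
        rw [map_mul, MulAut.mul_apply, hv₁]
      · obtain ⟨n, hn⟩ := hi
        refine ⟨n, ?_⟩
        simp only at hn ⊢
        rw [conj_zpow, hn]
        have : Commute l (l ^ i) := Commute.self_pow l i
        have h5 : Commute l (l ^ i)⁻¹ := this.inv_right
        calc l * (l ^ i * z₁ * (l ^ i)⁻¹) * l⁻¹
            = (l * l ^ i) * z₁ * ((l ^ i)⁻¹ * l⁻¹) := by group
          _ = (l ^ i * l) * z₁ * (l⁻¹ * (l ^ i)⁻¹) := by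
              rw [this.eq, (h5.inv_left).eq]
          _ = _ := by group
  -- The orbit product is nontrivial because `N z` sends it to v ^ q: a nontrivial image of a later
  -- factor would be fixed by z and by a conjugate of z outside ⟨z⟩.
  refine ⟨∏ i ∈ Finset.range (orderOf l), ρ (l ^ i) v, fun h => ?_,
    map_prod_pow_orbit ρ l (pow_orderOf_eq_one l) v⟩
  obtain ⟨k, hk⟩ : ∃ k, orderOf l = k + 1 := Nat.exists_eq_succ_of_ne_zero hlfin.orderOf_pos.ne'
  have h1 : ∀ i ∈ Finset.range k, N z (ρ (l ^ (i + 1)) v) = 1 := by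
    intro i hi
    have hi' := Finset.mem_range.1 hi
    by_contra hne
    have hconj := hnorm _ (pow_mem hl (i + 1)) z hz
    have h2 := hstab _ hne z hz _ hconj hz1 (hNinv z hz _) (by
      rw [← hNcomm z _ (hcomm z hz _ hconj), ← MulAut.mul_apply, ← map_mul]
      simp only [inv_mul_cancel_right]
      rw [map_mul, MulAut.mul_apply, hv])
    have h3 := Nat.le_of_dvd (Nat.succ_pos _) (orderOf_dvd_of_pow_eq_one (hlz _ h2))
    omega
  have h2 := congrArg (N z) h
  rw [hk, Finset.prod_range_succ', map_mul, map_prod, Finset.prod_congr rfl h1] at h2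
  simp only [Finset.prod_const_one, pow_zero, map_one, MulAut.one_apply, one_mul] at h2
  rw [hNfix z v hv] at h2
  exact hv1 (htors v h2)

end LinesAction

/-- The subgroup generated by y already accounts for all solutions of a ^ `orderOf y` = 1 that a
cyclic group can have. -/
lemma IsCyclic.mem_zpowers_of_orderOf_dvd {C : Type*} [Group C] [Finite C] [IsCyclic C] {x y : C}
    (h : orderOf x ∣ orderOf y) : x ∈ Subgroup.zpowers y := by
  classical
  have := Fintype.ofFinite C
  have hsub : (Subgroup.zpowers y : Set C).toFinset ⊆
      Finset.univ.filter fun a : C => a ^ orderOf y = 1 := by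
    intro a ha
    rw [Set.mem_toFinset] at ha
    simpa [← orderOf_dvd_iff_pow_eq_one] using orderOf_dvd_of_mem_zpowers ha
  have heq := Finset.eq_of_subset_of_card_le hsub (by
    refine (IsCyclic.card_pow_eq_one_le (orderOf_pos y)).trans ?_
    rw [Set.toFinset_card, ← Nat.card_eq_fintype_card]
    exact (Nat.card_zpowers y).ge)
  have hx : x ∈ Finset.univ.filter fun a : C => a ^ orderOf y = 1 := by
    simpa [← orderOf_dvd_iff_pow_eq_one] using h
  rw [← heq, Set.mem_toFinset] at hx
  exact hx

/-! ### Local consequences of claw-freeness, and a criterion for it. -/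

section ClawFree

/-- Coinciding leaves are absorbed by the equality alternative, so injectivity of f need not be
checked by callers. -/
lemma ClawFree.exists_adj {V : Type*} {Γ : SimpleGraph V} (h : ClawFree Γ) (c : V) (f : Fin 3 → V)
    (hf : ∀ i, Γ.Adj c (f i)) : ∃ i j, i ≠ j ∧ (f i = f j ∨ Γ.Adj (f i) (f j)) := by
  by_contra hcon
  push Not at hcon
  refine h ⟨⟨⟨Sum.elim (fun _ => c) f, ?_⟩, ?_⟩⟩
  · rintro (a | a) (b | b) hab
    · rw [Subsingleton.elim a b]
    · exact absurd hab (hf b).ne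
    · exact absurd hab.symm (hf a).ne
    · by_contra hne
      exact (hcon a b fun h => hne (congrArg _ h)).1 hab
  · rintro (a | a) (b | b)
    · change Γ.Adj c c ↔ _
      simp
    · change Γ.Adj c (f b) ↔ _
      simpa using hf b
    · change Γ.Adj (f a) c ↔ _
      simpa using (hf a).symm
    · change Γ.Adj (f a) (f b) ↔ _
      by_cases hab : a = b
      · simp [hab]
      · simp [(hcon a b hab).2]

lemma clawFree_of_exists_adj {V : Type*} {Γ : SimpleGraph V}
    (h : ∀ (c : V) (f : Fin 3 → V), (∀ i, Γ.Adj c (f i)) →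
      ∃ i j, i ≠ j ∧ (f i = f j ∨ Γ.Adj (f i) (f j))) : ClawFree Γ := by
  rintro ⟨e⟩
  obtain ⟨i, j, hij, h⟩ := h (e (Sum.inl 0)) (fun i => e (Sum.inr i))
    (fun i => e.map_adj_iff.2 (by simp))
  rcases h with h | h
  · exact hij (Sum.inr_injective (e.injective h))
  · simpa using e.map_adj_iff.1 h

variable {G : Type*} [Group G] [Finite G]

lemma exists_pos_pow_eq_iff {u v : G} : (∃ i : ℕ, 0 < i ∧ u = v ^ i) ↔ u ∈ Subgroup.zpowers v := by
  constructor
  · rintro ⟨i, -, rfl⟩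
    exact Subgroup.npow_mem_zpowers v i
  · intro h
    obtain ⟨i, rfl⟩ := mem_powers_iff_mem_zpowers.2 h
    -- Adding the order makes the exponent positive even when i = 0.
    exact ⟨i + orderOf v, Nat.add_pos_right _ (orderOf_pos v), by
      simp [pow_add, pow_orderOf_eq_one]⟩

lemma powerGraph_adj {u v : G} : (powerGraph G).Adj u v ↔
    u ≠ v ∧ (u ∈ Subgroup.zpowers v ∨ v ∈ Subgroup.zpowers u) := by
  rw [← exists_pos_pow_eq_iff, ← exists_pos_pow_eq_iff]
  rfl

lemma ClawFree.exists_mem_zpowers (h : ClawFree (reducedPowerGraph G)) {c : G} (hc : c ≠ 1)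
    (f : Fin 3 → G) (hf1 : ∀ i, f i ≠ 1)
    (hf : (∀ i, c ∈ Subgroup.zpowers (f i)) ∨ ∀ i, f i ∈ Subgroup.zpowers c) :
    ∃ i j, i ≠ j ∧ f i ∈ Subgroup.zpowers (f j) := by
  -- A centre that is itself a leaf is already comparable with the next leaf.
  by_cases hcf : ∃ i, c = f i
  · obtain ⟨i, rfl⟩ := hcf
    have hne : i ≠ i + 1 := (by decide : ∀ i : Fin 3, i ≠ i + 1) i
    rcases hf with hf | hf
    · exact ⟨i, i + 1, hne, hf _⟩
    · exact ⟨i + 1, i, hne.symm, hf _⟩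
  · push Not at hcf
    obtain ⟨i, j, hij, h⟩ := h.exists_adj ⟨c, hc⟩ (fun i => ⟨f i, hf1 i⟩) (fun i => by
      refine powerGraph_adj.2 ⟨hcf i, ?_⟩
      rcases hf with hf | hf
      · exact Or.inl (hf i)
      · exact Or.inr (hf i))
    rcases h with h | h
    · refine ⟨i, j, hij, ?_⟩
      rw [show f i = f j from congrArg Subtype.val h]
      exact Subgroup.mem_zpowers _
    · rcases (powerGraph_adj.1 h).2 with h | h
      · exact ⟨i, j, hij, h⟩
      · exact ⟨j, i, hij.symm, h⟩

/-- If all centralizers of nonidentity elements are cyclic of order dividing a product of two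
distinct primes, the reduced power graph is claw-free. -/
lemma clawFree_of_centralizer
    (h : ∀ c : G, c ≠ 1 → ∃ p q : ℕ, p.Prime ∧ q.Prime ∧
      IsCyclic (Subgroup.centralizer {c}) ∧ Nat.card (Subgroup.centralizer {c}) ∣ p * q) :
    ClawFree (reducedPowerGraph G) := by
  refine clawFree_of_exists_adj fun ⟨c, hc⟩ f hf => ?_
  obtain ⟨p, q, hp, hq, hcyc, hcard⟩ := h c hc
  have hmem : ∀ i, (f i : G) ∈ Subgroup.centralizer {c} := by
    intro i
    rw [Subgroup.mem_centralizer_singleton_iff]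
    rcases (powerGraph_adj.1 (hf i)).2 with h | h
    · obtain ⟨n, hn⟩ := h
      have : (f i : G) ^ n = c := hn
      rw [← this]
      exact (Commute.self_zpow _ n).eq
    · obtain ⟨n, hn⟩ := h
      have : c ^ n = (f i : G) := hn
      rw [← this]
      exact (Commute.zpow_self c n).eq
  have hdvd : ∀ i, orderOf (f i : G) ∣ p * q := fun i =>
    (Subgroup.orderOf_dvd_natCard _ (hmem i)).trans hcard
  have hne : ∀ i, orderOf (f i : G) ≠ 1 := fun i h => (f i).2 (orderOf_eq_one_iff.1 h)
  have hord : ∀ i, orderOf (f i : G) = p ∨ orderOf (f i : G) = q ∨ orderOf (f i : G) = p * q := by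
    intro i
    obtain ⟨a, b, ha, hb, hab⟩ := exists_dvd_and_dvd_of_dvd_mul (hdvd i)
    have := hne i
    rcases (Nat.dvd_prime hp).1 ha with rfl | rfl <;> rcases (Nat.dvd_prime hq).1 hb with rfl | rfl
      <;> simp_all
  -- Either some order is the full pq, or two of the three orders coincide by pigeonhole on {p, q}.
  have hpair : ∃ i j, i ≠ j ∧ orderOf (f i : G) ∣ orderOf (f j : G) := by
    by_cases hall : ∃ i, orderOf (f i : G) = p * q
    · obtain ⟨i, hi⟩ := hall
      have hne : i ≠ i + 1 := (by decide : ∀ i : Fin 3, i ≠ i + 1) i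
      exact ⟨i + 1, i, hne.symm, hi ▸ hdvd _⟩
    · push Not at hall
      obtain ⟨i, j, hij, h⟩ := Fintype.exists_ne_map_eq_of_card_lt
        (fun i : Fin 3 => decide (orderOf (f i : G) = p)) (by simp)
      refine ⟨i, j, hij, ?_⟩
      have h' : orderOf (f i : G) = p ↔ orderOf (f j : G) = p := by simpa using h
      rcases hord i with h1 | h1 | h1
      · rw [h1, h'.1 h1]
      · rcases hord j with h2 | h2 | h2
        · rw [h2, h'.2 h2]
        · rw [h1, h2]
        · exact absurd h2 (hall j)
      · exact absurd h1 (hall i)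
  obtain ⟨i, j, hij, h⟩ := hpair
  refine ⟨i, j, hij, or_iff_not_imp_left.2 fun hne => powerGraph_adj.2
    ⟨fun h => hne (Subtype.ext h), Or.inl ?_⟩⟩
  have h1 : (⟨f i, hmem i⟩ : Subgroup.centralizer {c}) ∈
      Subgroup.zpowers (⟨f j, hmem j⟩ : Subgroup.centralizer {c}) := by
    refine IsCyclic.mem_zpowers_of_orderOf_dvd ?_
    simpa only [Subgroup.orderOf_mk] using h
  obtain ⟨n, hn⟩ := h1
  exact Subgroup.mem_zpowers_iff.2 ⟨n, congrArg Subtype.val hn⟩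

lemma not_mem_zpowers_of_coprime {G : Type*} [Group G] {a b : G} (ha : a ≠ 1)
    (h : (orderOf a).Coprime (orderOf b)) : a ∉ Subgroup.zpowers b := fun hab =>
  ha (orderOf_eq_one_iff.1 (Nat.Coprime.eq_one_of_dvd h (orderOf_dvd_of_mem_zpowers hab)))

lemma Commute.left_mem_zpowers_mul {G : Type*} [Group G] {a b : G} (hab : Commute a b)
    (h : (orderOf a).Coprime (orderOf b)) : a ∈ Subgroup.zpowers (a * b) := by
  have h1 : a ∈ Subgroup.zpowers (a ^ orderOf b) := mem_zpowers_pow_iff.2 h.symm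
  have h2 : a ^ orderOf b ∈ Subgroup.zpowers (a * b) :=
    Subgroup.mem_zpowers_iff.2 ⟨orderOf b, by
      rw [zpow_natCast, hab.mul_pow, pow_orderOf_eq_one, mul_one]⟩
  exact Subgroup.zpowers_le.2 h2 h1

lemma orderOf_ne_one_of_prime {G : Type*} [Group G] {a : G} (h : (orderOf a).Prime) : a ≠ 1 :=
  fun h1 => h.ne_one (orderOf_eq_one_iff.2 h1)

/-- No three commuting elements have distinct prime orders. -/
lemma ClawFree.not_three_orders (h : ClawFree (reducedPowerGraph G)) {a b c : G}
    (hab : Commute a b) (hac : Commute a c) (hbc : Commute b c)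
    (ha : (orderOf a).Prime) (hb : (orderOf b).Prime) (hc : (orderOf c).Prime)
    (h1 : orderOf a ≠ orderOf b) (h2 : orderOf a ≠ orderOf c) (h3 : orderOf b ≠ orderOf c) :
    False := by
  have c1 := (Nat.coprime_primes ha hb).2 h1
  have c2 := (Nat.coprime_primes ha hc).2 h2
  have c3 := (Nat.coprime_primes hb hc).2 h3
  have key : ∀ x y z : G, Commute x y → Commute x z → Commute y z →
      (orderOf x).Coprime (orderOf y) → (orderOf x).Coprime (orderOf z) →
      x ∈ Subgroup.zpowers (x * (y * z)) := by
    intro x y z hxy hxz hyz h h'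
    refine (hxy.mul_right hxz).left_mem_zpowers_mul ?_
    exact Nat.Coprime.coprime_dvd_right hyz.orderOf_mul_dvd_mul_orderOf (h.mul_right h')
  have ma := key a b c hab hac hbc c1 c2
  have mb := key b a c hab.symm hbc hac c1.symm c3
  have mc := key c a b hac.symm hbc.symm hab c2.symm c3.symm
  rw [← mul_assoc, ← hab.eq, mul_assoc] at mb
  rw [(hac.symm.mul_right hbc.symm).eq, mul_assoc] at mc
  have na := orderOf_ne_one_of_prime ha
  have nb := orderOf_ne_one_of_prime hb
  have nc := orderOf_ne_one_of_prime hc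
  -- The claw has centre abc and leaves a, b, c.
  obtain ⟨i, j, hij, hm⟩ := h.exists_mem_zpowers (c := a * (b * c))
    (by intro h; rw [h] at ma; simp at ma; exact na ma) ![a, b, c]
    (by intro i; fin_cases i <;> assumption) (Or.inr (by intro i; fin_cases i <;> assumption))
  fin_cases i <;> fin_cases j <;> first
    | exact hij rfl
    | exact not_mem_zpowers_of_coprime na c1 hm
    | exact not_mem_zpowers_of_coprime na c2 hm
    | exact not_mem_zpowers_of_coprime nb c1.symm hm
    | exact not_mem_zpowers_of_coprime nb c3 hm
    | exact not_mem_zpowers_of_coprime nc c2.symm hm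
    | exact not_mem_zpowers_of_coprime nc c3.symm hm

/-- The elements of prime order `≠ p` centralizing an element of order `p` have at most two
orders. -/
lemma ClawFree.not_three_neighbors (h : ClawFree (reducedPowerGraph G)) {z a b c : G}
    (hza : Commute z a) (hzb : Commute z b) (hzc : Commute z c) (hz : (orderOf z).Prime)
    (ha : (orderOf a).Prime) (hb : (orderOf b).Prime) (hc : (orderOf c).Prime)
    (hna : orderOf z ≠ orderOf a) (hnb : orderOf z ≠ orderOf b) (hnc : orderOf z ≠ orderOf c)
    (h1 : orderOf a ≠ orderOf b) (h2 : orderOf a ≠ orderOf c) (h3 : orderOf b ≠ orderOf c) :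
    False := by
  have key : ∀ x : G, Commute z x → (orderOf x).Prime → orderOf z ≠ orderOf x →
      z ∈ Subgroup.zpowers (z * x) ∧ x ∈ Subgroup.zpowers (z * x) := by
    intro x hx hp hne
    have hcop := (Nat.coprime_primes hz hp).2 hne
    refine ⟨hx.left_mem_zpowers_mul hcop, ?_⟩
    rw [hx.eq]
    exact hx.symm.left_mem_zpowers_mul hcop.symm
  have key2 : ∀ x y : G, Commute z x → Commute z y → (orderOf x).Prime → (orderOf y).Prime →
      orderOf z ≠ orderOf x → orderOf x ≠ orderOf y →
      z * x ∉ Subgroup.zpowers (z * y) := by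
    intro x y hx hy hpx hpy hzx hxy hm
    refine not_mem_zpowers_of_coprime (orderOf_ne_one_of_prime hpx)
      ((Nat.coprime_primes hpx hpy).2 hxy) (b := y) ?_
    refine hy.mem_zpowers_of_mem_zpowers_mul ?_ ((Nat.coprime_primes hz hpx).2 hzx)
    exact (Subgroup.zpowers_le.2 hm) (key x hx hpx hzx).2
  have nz := orderOf_ne_one_of_prime hz
  have hne : ∀ x : G, z ∈ Subgroup.zpowers x → x ≠ 1 := by
    rintro x hx rfl
    simp at hx
    exact nz hx
  have ka := (key a hza ha hna).1
  have kb := (key b hzb hb hnb).1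
  have kc := (key c hzc hc hnc).1
  obtain ⟨i, j, hij, hm⟩ := h.exists_mem_zpowers nz ![z * a, z * b, z * c]
    (by intro i; fin_cases i <;> (apply hne; assumption))
    (Or.inl (by intro i; fin_cases i <;> assumption))
  fin_cases i <;> fin_cases j <;> first
    | exact hij rfl
    | exact key2 a b hza hzb ha hb hna h1 hm
    | exact key2 a c hza hzc ha hc hna h2 hm
    | exact key2 b a hzb hza hb ha hnb h1.symm hm
    | exact key2 b c hzb hzc hb hc hnb h3 hm
    | exact key2 c a hzc hza hc ha hnc h2.symm hm
    | exact key2 c b hzc hzb hc hb hnc h3.symm hm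

/-- Elementary abelian subgroups centralizing an element of coprime prime order are cyclic. -/
lemma ClawFree.mem_zpowers_of_commute (h : ClawFree (reducedPowerGraph G)) {q : ℕ} (hq : q.Prime)
    {z a b : G} (hz : (orderOf z).Prime) (hzq : orderOf z ≠ q) (ha : a ^ q = 1) (hb : b ^ q = 1)
    (ha1 : a ≠ 1) (hab : Commute a b) (hza : Commute z a) (hzb : Commute z b) :
    b ∈ Subgroup.zpowers a := by
  have := Fact.mk hq
  by_contra hcon
  have hb1 : b ≠ 1 := fun h => hcon (h ▸ one_mem _)
  have hcop : ∀ x : G, x ^ q = 1 → (orderOf z).Coprime (orderOf x) := fun x hx =>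
    Nat.Coprime.coprime_dvd_right (orderOf_dvd_of_pow_eq_one hx)
      ((Nat.coprime_primes hz hq).2 hzq)
  have hab' : (a * b) ^ q = 1 := by rw [hab.mul_pow, ha, hb, one_mul]
  have hab1 : a * b ≠ 1 := fun h => hcon (by
    rw [← inv_eq_of_mul_eq_one_right h]
    exact inv_mem (Subgroup.mem_zpowers a))
  have nz := orderOf_ne_one_of_prime hz
  have hne : ∀ x : G, z ∈ Subgroup.zpowers x → x ≠ 1 := by
    rintro x hx rfl
    simp at hx
    exact nz hx
  have key : ∀ x y : G, Commute z x → Commute z y → x ^ q = 1 →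
      z * x ∈ Subgroup.zpowers (z * y) → x ∈ Subgroup.zpowers y := by
    intro x y hx hy hxq hm
    refine hy.mem_zpowers_of_mem_zpowers_mul (Subgroup.zpowers_le.2 hm ?_) (hcop x hxq)
    rw [hx.eq]
    exact hx.symm.left_mem_zpowers_mul (hcop x hxq).symm
  have ka := hza.left_mem_zpowers_mul (hcop a ha)
  have kb := hzb.left_mem_zpowers_mul (hcop b hb)
  have kab := (hza.mul_right hzb).left_mem_zpowers_mul (hcop _ hab')
  have key2 : a * b ∉ Subgroup.zpowers a := fun hm =>
    hcon (by simpa using mul_mem (inv_mem (Subgroup.mem_zpowers a)) hm)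
  have key3 : a ∉ Subgroup.zpowers b := fun hm => hcon (mem_zpowers_swap hq hb ha1 hm)
  have key4 : a * b ∉ Subgroup.zpowers b := fun hm =>
    key3 (by simpa using mul_mem hm (inv_mem (Subgroup.mem_zpowers b)))
  -- The claw has centre z; its leaves come from three distinct subgroups of order q in the group
  -- generated by a and b.
  obtain ⟨i, j, hij, hm⟩ := h.exists_mem_zpowers nz ![z * a, z * b, z * (a * b)]
    (by intro i; fin_cases i <;> (apply hne; assumption))
    (Or.inl (by intro i; fin_cases i <;> assumption))
  fin_cases i <;> fin_cases j <;> first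
    | exact hij rfl
    | exact key3 (key a b hza hzb ha hm)
    | exact hcon (key b a hzb hza hb hm)
    | exact key2 (key _ a (hza.mul_right hzb) hza hab' hm)
    | exact key4 (key _ b (hza.mul_right hzb) hzb hab' hm)
    | exact key2 (mem_zpowers_swap hq hab' ha1 (key a _ hza (hza.mul_right hzb) ha hm))
    | exact key4 (mem_zpowers_swap hq hab' hb1 (key b _ hzb (hza.mul_right hzb) hb hm))

end ClawFree

/-! ### Invariant elementary abelian subgroups and p-complements. -/

section Elementary

variable {G : Type*} [Group G]

/-- `Q` is a nontrivial elementary abelian `q`-group normalized by `K`. -/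
structure IsInvariantElementary (K Q : Subgroup G) (q : ℕ) : Prop where
  prime : q.Prime
  exists_ne_one : ∃ x ∈ Q, x ≠ 1
  conj_mem : ∀ k ∈ K, ∀ x ∈ Q, k * x * k⁻¹ ∈ Q
  commute : ∀ x ∈ Q, ∀ y ∈ Q, Commute x y
  pow_eq_one : ∀ x ∈ Q, x ^ q = 1

lemma IsInvariantElementary.mono {K J Q : Subgroup G} {q : ℕ} (h : IsInvariantElementary K Q q)
    (hJ : J ≤ K) : IsInvariantElementary J Q q :=
  ⟨h.prime, h.exists_ne_one, fun k hk => h.conj_mem k (hJ hk), h.commute, h.pow_eq_one⟩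

lemma IsInvariantElementary.orderOf_eq {K Q : Subgroup G} {q : ℕ}
    (h : IsInvariantElementary K Q q) {x : G} (hx : x ∈ Q) (hx1 : x ≠ 1) : orderOf x = q := by
  have := Fact.mk h.prime
  exact orderOf_eq_prime (h.pow_eq_one x hx) hx1

/-- Passing to the strictly smaller normal subgroup ⁅M, M⁆ reduces to abelian M, where the elements
killed by a prime q dividing |M| form Q. -/
lemma exists_normal_elementary_le [Finite G] [Group.IsSolvable G] (M : Subgroup G) [M.Normal]
    (hM : M ≠ ⊥) : ∃ q, ∃ Q ≤ M, IsInvariantElementary ⊤ Q q := by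
  obtain ⟨n, hn⟩ : ∃ n, Nat.card M = n := ⟨_, rfl⟩
  induction n using Nat.strong_induction_on generalizing M with
  | _ n ih =>
  by_cases hcomm : ⁅M, M⁆ = ⊥
  · obtain ⟨q, hq, hqM⟩ := Nat.exists_prime_and_dvd (n := Nat.card M)
      (fun h => hM (Subgroup.card_eq_one.1 h))
    have hc : ∀ x ∈ M, ∀ y ∈ M, Commute x y := by
      intro x hx y hy
      have := Subgroup.commutator_mem_commutator hx hy
      rw [hcomm, Subgroup.mem_bot] at this
      exact commutatorElement_eq_one_iff_commute.1 this
    have := Fact.mk hq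
    obtain ⟨x, hx⟩ := exists_prime_orderOf_dvd_card' q hqM
    let Q : Subgroup G :=
      { carrier := {x | x ∈ M ∧ x ^ q = 1}
        mul_mem' := fun {a b} ha hb => ⟨mul_mem ha.1 hb.1, by
          rw [(hc a ha.1 b hb.1).mul_pow, ha.2, hb.2, one_mul]⟩
        one_mem' := ⟨one_mem _, one_pow _⟩
        inv_mem' := fun {a} ha => ⟨inv_mem ha.1, by rw [inv_pow, ha.2, inv_one]⟩ }
    refine ⟨q, Q, fun x hx => hx.1, hq, ⟨x, ⟨x.2, ?_⟩, ?_⟩, ?_, ?_, fun x hx => hx.2⟩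
    · rw [← hx, ← Subgroup.orderOf_coe, pow_orderOf_eq_one]
    · intro h
      rw [← Subgroup.orderOf_coe, h, orderOf_one] at hx
      exact hq.ne_one hx.symm
    · intro k _ x hx
      exact ⟨Subgroup.Normal.conj_mem inferInstance x hx.1 k, by rw [conj_pow, hx.2]; simp⟩
    · exact fun x hx y hy => hc x hx.1 y hy.1
  · have hlt := Group.IsSolvable.commutator_lt_of_ne_bot hM
    obtain ⟨q, Q, hQ, h⟩ := ih _ (by
      rw [← hn]
      exact Set.Finite.card_lt_card (Set.toFinite _) hlt) ⁅M, M⁆ hcomm rfl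
    exact ⟨q, Q, hQ.trans hlt.le, h⟩

lemma exists_invariantElementary_le [Finite G] [Group.IsSolvable G] {K M : Subgroup G} (hMK : M ≤ K)
    (hM : ∃ x ∈ M, x ≠ 1) (hconj : ∀ k ∈ K, ∀ x ∈ M, k * x * k⁻¹ ∈ M) :
    ∃ q, ∃ Q ≤ M, IsInvariantElementary K Q q := by
  obtain ⟨x, hx, hx1⟩ := hM
  have hnorm : (M.subgroupOf K).Normal := ⟨fun x hx k => hconj k k.2 x hx⟩
  obtain ⟨q, Q, hQ, h⟩ := exists_normal_elementary_le (M.subgroupOf K) (by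
    rw [Subgroup.ne_bot_iff_exists_ne_one]
    exact ⟨⟨⟨x, hMK hx⟩, hx⟩, fun h => hx1 (congrArg (fun a : M.subgroupOf K => ((a : K) : G)) h)⟩)
  refine ⟨q, Q.map K.subtype, ?_, h.prime, ?_, ?_, ?_, ?_⟩
  · rintro _ ⟨y, hy, rfl⟩
    exact hQ hy
  · obtain ⟨y, hy, hy1⟩ := h.exists_ne_one
    exact ⟨y, ⟨y, hy, rfl⟩, by simpa using hy1⟩
  · rintro k hk _ ⟨y, hy, rfl⟩
    exact ⟨_, h.conj_mem ⟨k, hk⟩ trivial y hy, rfl⟩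
  · rintro _ ⟨y, hy, rfl⟩ _ ⟨z, hz, rfl⟩
    exact (h.commute y hy z hz).map K.subtype
  · rintro _ ⟨y, hy, rfl⟩
    simpa using congrArg K.subtype (h.pow_eq_one y hy)

lemma exists_mem_orderOf_eq [Finite G] {J : Subgroup G} {q : ℕ} (hq : q.Prime)
    (h : q ∣ Nat.card J) : ∃ x ∈ J, orderOf x = q := by
  have := Fact.mk hq
  obtain ⟨x, hx⟩ := exists_prime_orderOf_dvd_card' q h
  exact ⟨x, x.2, by rw [Subgroup.orderOf_coe, hx]⟩

lemma IsInvariantElementary.card_eq_pow [Finite G] {K Q : Subgroup G} {q : ℕ}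
    (h : IsInvariantElementary K Q q) : ∃ n, Nat.card Q = q ^ n := by
  have := Fact.mk h.prime
  have hp : IsPGroup q Q := fun x => ⟨1, Subtype.ext (by simpa using h.pow_eq_one x x.2)⟩
  exact IsPGroup.iff_card.1 hp

/-- A finite solvable group has a `p`-complement. -/
lemma exists_pComplement {p : ℕ} (hp : p.Prime) (G : Type*) [Group G] [Finite G]
    [Group.IsSolvable G] : ∃ K : Subgroup G, ¬ p ∣ Nat.card K ∧ ∃ k, K.index = p ^ k := by
  obtain ⟨n, hn⟩ : ∃ n, Nat.card G = n := ⟨_, rfl⟩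
  induction n using Nat.strong_induction_on generalizing G with
  | _ n ih =>
  by_cases hpG : p ∣ Nat.card G
  swap
  · exact ⟨⊤, by simpa using hpG, 0, by simp⟩
  have hnt : (⊤ : Subgroup G) ≠ ⊥ := by
    intro h
    rw [← Subgroup.card_eq_one, Subgroup.card_top] at h
    rw [h] at hpG
    exact hp.one_lt.ne' (Nat.dvd_one.1 hpG)
  obtain ⟨r, N, -, hN⟩ := exists_normal_elementary_le (⊤ : Subgroup G) hnt
  have hnorm : N.Normal := ⟨fun x hx k => hN.conj_mem k trivial x hx⟩
  obtain ⟨a, ha⟩ := hN.card_eq_pow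
  have hcardG : Nat.card G = Nat.card (G ⧸ N) * Nat.card N := Subgroup.card_eq_card_quotient_mul_card_subgroup N
  have hlt : Nat.card (G ⧸ N) < n := by
    rw [← hn, hcardG]
    refine lt_mul_of_one_lt_right Nat.card_pos ?_
    obtain ⟨x, hx, hx1⟩ := hN.exists_ne_one
    have := (Subgroup.one_lt_card_iff_ne_bot N).2
      (Subgroup.ne_bot_iff_exists_ne_one.2 ⟨⟨x, hx⟩, fun h => hx1 (congrArg Subtype.val h)⟩)
    exact this
  obtain ⟨K', hK', k, hk⟩ := ih _ hlt (G ⧸ N) rfl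
  -- The preimage of a p-complement of G/N has the right index; it is itself a p-complement unless N
  -- is a p-group.
  set K := K'.comap (QuotientGroup.mk' N) with hKdef
  have hindex : K.index = p ^ k := by
    rw [← hk]
    exact Subgroup.index_comap_of_surjective _ (QuotientGroup.mk'_surjective N)
  have hcardK : Nat.card K = Nat.card K' * Nat.card N := by
    have h1 := K.card_mul_index
    have h2 := K'.card_mul_index
    rw [hcardG, ← h2, hindex, hk] at h1
    refine Nat.eq_of_mul_eq_mul_right (pow_pos hp.pos k) ?_
    rw [h1]
    ring
  have hNK : N ≤ K := by
    intro x hx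
    rw [hKdef, Subgroup.mem_comap]
    have : QuotientGroup.mk' N x = 1 := (QuotientGroup.eq_one_iff x).2 hx
    rw [this]
    exact one_mem _
  by_cases hrp : r = p
  · subst hrp
    have hcN : Nat.card (N.subgroupOf K) = Nat.card N :=
      Nat.card_congr (Subgroup.subgroupOfEquivOfLe hNK).toEquiv
    have hiN : (N.subgroupOf K).index = Nat.card K' := by
      have := (N.subgroupOf K).card_mul_index
      rw [hcN, hcardK, mul_comm] at this
      exact Nat.eq_of_mul_eq_mul_right Nat.card_pos this
    -- When N is a p-group, Schur–Zassenhaus splits it off K.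
    obtain ⟨H, hH⟩ := Subgroup.exists_right_complement'_of_coprime (N := N.subgroupOf K) (by
      rw [hcN, hiN, ha]
      exact Nat.Coprime.pow_left _ ((Nat.Prime.coprime_iff_not_dvd hp).2 hK'))
    have hcH : Nat.card H = Nat.card K' := by
      have := hH.card_mul_card
      rw [hcN, hcardK, mul_comm] at this
      exact Nat.eq_of_mul_eq_mul_right Nat.card_pos this
    have hcH' : Nat.card (H.map K.subtype) = Nat.card K' := by
      rw [← hcH]
      exact Subgroup.card_map_of_injective K.subtype_injective
    refine ⟨H.map K.subtype, by rwa [hcH'], a + k, ?_⟩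
    have h1 := (H.map K.subtype).card_mul_index
    rw [hcH', hcardG, ← K'.card_mul_index, hk, ha, mul_assoc] at h1
    rw [Nat.eq_of_mul_eq_mul_left Nat.card_pos h1, pow_add, mul_comm]
  · refine ⟨K, ?_, k, hindex⟩
    rw [hcardK, hp.dvd_mul, ha, not_or]
    exact ⟨hK', fun h => hrp ((Nat.prime_dvd_prime_iff_eq hp hN.prime).1
      (hp.dvd_of_dvd_pow h)).symm⟩

/-- The index is a power of p, so p is the only prime divisor that can be lost. -/
lemma exists_pComplement_le [Finite G] [Group.IsSolvable G] {p : ℕ} (hp : p.Prime)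
    (K : Subgroup G) : ∃ J ≤ K, ¬ p ∣ Nat.card J ∧
      (Nat.card K).primeFactors.card ≤ (Nat.card J).primeFactors.card + 1 := by
  obtain ⟨J, hJ, k, hk⟩ := exists_pComplement hp K
  have hcard : Nat.card (J.map K.subtype) = Nat.card J :=
    Subgroup.card_map_of_injective K.subtype_injective
  refine ⟨J.map K.subtype, ?_, by rwa [hcard], ?_⟩
  · rintro _ ⟨x, -, rfl⟩
    exact x.2
  · rw [hcard]
    refine (Finset.card_le_card (t := insert p (Nat.card J).primeFactors) ?_).trans
      (Finset.card_insert_le _ _)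
    intro q hq
    have hqp := Nat.prime_of_mem_primeFactors hq
    have hdvd := Nat.dvd_of_mem_primeFactors hq
    rw [← J.card_mul_index, hk, hqp.dvd_mul] at hdvd
    rw [Finset.mem_insert, Nat.mem_primeFactors]
    rcases hdvd with h | h
    · exact Or.inr ⟨hqp, h, Nat.card_pos.ne'⟩
    · exact Or.inl ((Nat.prime_dvd_prime_iff_eq hqp hp).1 (hqp.dvd_of_dvd_pow h))

lemma IsInvariantElementary.eq_one_of_pow_eq_one {K N : Subgroup G} {p : ℕ}
    (hN : IsInvariantElementary K N p) {q : ℕ} (hq : q.Prime) (hqp : q ≠ p) {x : G}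
    (hx : x ∈ N) (h : x ^ q = 1) : x = 1 := by
  have h1 := Nat.dvd_gcd (orderOf_dvd_of_pow_eq_one h) (orderOf_dvd_of_pow_eq_one
    (hN.pow_eq_one x hx))
  rw [(Nat.coprime_primes hq hN.prime).2 hqp] at h1
  exact orderOf_eq_one_iff.1 (Nat.dvd_one.1 h1)

/-- This is `trivial_action_of_fixedPointFree` for ⟨y⟩ conjugating N: if w fixed nothing in N, then
y would centralize N. -/
lemma IsInvariantElementary.exists_commute_of_semiregular [Finite G] {N : Subgroup G} {p : ℕ}
    (hN : IsInvariantElementary ⊤ N p) {q : ℕ} (hq : q.Prime) (hqp : q ≠ p)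
    {y w : G} (hyq : orderOf y = q) (hwy : w * y * w⁻¹ ∈ Subgroup.zpowers y)
    (hfree : ∀ i : ℕ, w ^ i ≠ 1 → ¬ Commute (w ^ i) y) (hy : ¬ ∀ c ∈ N, Commute y c) :
    ∃ c ∈ N, c ≠ 1 ∧ Commute w c := by
  have hnorm : N.Normal := ⟨fun x hx k => hN.conj_mem k trivial x hx⟩
  let _ : CommGroup N :=
    { (inferInstance : Group N) with
      mul_comm := fun x y => Subtype.ext (hN.commute x x.2 y y.2) }
  have hyq' : y ^ q = 1 := hyq ▸ pow_orderOf_eq_one y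
  by_contra hcon
  push Not at hcon
  apply hy
  intro c hc
  have h := trivial_action_of_fixedPointFree (MulAut.conjNormal (H := N)) (Subgroup.zpowers y) w
    (isOfFinOrder_of_finite w) ?_ ?_ ?_ ?_ ⟨c, hc⟩ (Subgroup.mem_zpowers y)
  · have := congrArg Subtype.val h
    rw [MulAut.conjNormal_apply] at this
    exact mul_inv_eq_iff_eq_mul.1 this
  · rintro _ ⟨n, rfl⟩
    simp only
    rw [← conj_zpow]
    exact zpow_mem hwy n
  · intro i hi x hx hcx
    by_contra hx1
    refine hfree i hi ?_
    obtain ⟨n, hn⟩ := mem_zpowers_swap hq hyq' hx1 hx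
    rw [← show x ^ n = y from hn]
    exact Commute.zpow_right hcx n
  · intro v hv
    rw [Nat.card_zpowers, hyq] at hv
    exact Subtype.ext (hN.eq_one_of_pow_eq_one hq hqp v.2 (by simpa using congrArg Subtype.val hv))
  · intro v hv
    by_contra hv1
    refine hcon v v.2 (fun h => hv1 (Subtype.ext h)) ?_
    have := congrArg Subtype.val hv
    rw [MulAut.conjNormal_apply] at this
    exact mul_inv_eq_iff_eq_mul.1 this

/-- This is `exists_fixedPoint_of_commute` for conjugation on N; the element it yields is nontrivial
because b ∉ ⟨a⟩. -/
lemma IsInvariantElementary.exists_commute_of_noncyclic [Finite G] {N : Subgroup G} {p : ℕ}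
    (hN : IsInvariantElementary ⊤ N p) {q : ℕ} {K Q : Subgroup G}
    (hQ : IsInvariantElementary K Q q) (hqp : q ≠ p) {a b : G} (ha : a ∈ Q) (hb : b ∈ Q)
    (ha1 : a ≠ 1) (hba : b ∉ Subgroup.zpowers a) :
    ∃ z ∈ Q, z ≠ 1 ∧ ∃ c ∈ N, c ≠ 1 ∧ Commute z c := by
  have hnorm : N.Normal := ⟨fun x hx k => hN.conj_mem k trivial x hx⟩
  let _ : CommGroup N :=
    { (inferInstance : Group N) with
      mul_comm := fun x y => Subtype.ext (hN.commute x x.2 y y.2) }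
  obtain ⟨v, hv, hv1⟩ := hN.exists_ne_one
  obtain ⟨z, hz, u, -, hu1, hzu⟩ := exists_fixedPoint_of_commute (MulAut.conjNormal (H := N))
    hQ.prime (hQ.commute a ha b hb) (hQ.pow_eq_one a ha) (hQ.pow_eq_one b hb) ⊤
    (fun _ _ => trivial) (fun _ _ => trivial)
    (fun v hv => Subtype.ext (hN.eq_one_of_pow_eq_one hQ.prime hqp v.2
      (by simpa using congrArg Subtype.val hv))) (v := ⟨v, hv⟩) trivial
    (fun h => hv1 (congrArg Subtype.val h))
  refine ⟨z, ?_, ?_, u, u.2, fun h => hu1 (Subtype.ext h), ?_⟩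
  · rcases hz with rfl | ⟨i, rfl⟩
    · exact hb
    · exact mul_mem ha (pow_mem hb i)
  · rcases hz with rfl | ⟨i, rfl⟩
    · rintro rfl
      exact hba (one_mem _)
    · refine fun h => hba (mem_zpowers_swap hQ.prime (hQ.pow_eq_one b hb) ha1 ?_)
      rw [mul_eq_one_iff_eq_inv.1 h]
      exact inv_mem (Subgroup.npow_mem_zpowers b i)
  · have := congrArg Subtype.val hzu
    rw [MulAut.conjNormal_apply] at this
    exact mul_inv_eq_iff_eq_mul.1 this

end Elementary

/-! ### The bound on the number of primes. -/

section Bound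

lemma ne_of_orderOf_mem {G : Type*} [Group G] {J : Subgroup G} {p : ℕ} (hJ : ¬ p ∣ Nat.card J) {x : G} (hx : x ∈ J) :
    orderOf x ≠ p := fun h => hJ (h ▸ Subgroup.orderOf_dvd_natCard J hx)

variable {G : Type*} [Group G] [Finite G]

/-- A solvable group whose order has three prime divisors has commuting elements of distinct
prime orders. -/
lemma exists_commute_of_three_primes (G : Type*) [Group G] [Finite G] [Group.IsSolvable G]
    (h : 3 ≤ (Nat.card G).primeFactors.card) :
    ∃ a b : G, Commute a b ∧ (orderOf a).Prime ∧ (orderOf b).Prime ∧ orderOf a ≠ orderOf b := by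
  by_contra hcon
  push Not at hcon
  have htop : (⊤ : Subgroup G) ≠ ⊥ := by
    intro h1
    rw [← Subgroup.card_eq_one, Subgroup.card_top] at h1
    simp [h1] at h
  obtain ⟨r, R, -, hR⟩ := exists_normal_elementary_le (⊤ : Subgroup G) htop
  obtain ⟨M, -, hrM, hM⟩ := exists_pComplement_le hR.prime (⊤ : Subgroup G)
  rw [Subgroup.card_top] at hM
  have hM1 : ∃ x ∈ M, x ≠ 1 := by
    by_contra h1
    push Not at h1
    have h2 : M = ⊥ := (Subgroup.eq_bot_iff_forall M).2 h1
    rw [h2] at hM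
    simp at hM
    omega
  obtain ⟨s, S, hSM, hS⟩ := exists_invariantElementary_le le_rfl hM1
    (fun k hk x hx => mul_mem (mul_mem hk hx) (inv_mem hk))
  obtain ⟨a, ha, ha1⟩ := hS.exists_ne_one
  have hoa := hS.orderOf_eq ha ha1
  have hsr : s ≠ r := hoa ▸ ne_of_orderOf_mem hrM (hSM ha)
  have hfix : ∀ x c : G, (orderOf x).Prime → orderOf x ≠ r → c ∈ R → c ≠ 1 → ¬ Commute x c := by
    intro x c hx hxr hc hc1 hxc
    have hoc := hR.orderOf_eq hc hc1
    exact hxr ((hcon x c hxc hx (hoc ▸ hR.prime)).trans hoc)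
  by_cases hcyc : ∃ b ∈ S, b ∉ Subgroup.zpowers a
  · obtain ⟨b, hb, hba⟩ := hcyc
    obtain ⟨z, hz, hz1, c, hc, hc1, hzc⟩ := hR.exists_commute_of_noncyclic hS hsr ha hb ha1 hba
    have hoz := hS.orderOf_eq hz hz1
    exact hfix z c (hoz ▸ hS.prime) (hoz ▸ hsr) hc hc1 hzc
  · push Not at hcyc
    -- When S is cyclic, an element w of another prime order t acts semiregularly on it, since
    -- otherwise w and a would commute; hence w fixes a point of R.
    obtain ⟨t, ht, hts⟩ := Finset.exists_mem_ne (s := (Nat.card M).primeFactors) (by omega) s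
    obtain ⟨w, hw, how⟩ := exists_mem_orderOf_eq (Nat.prime_of_mem_primeFactors ht)
      (Nat.dvd_of_mem_primeFactors ht)
    have hpw : (orderOf w).Prime := how ▸ Nat.prime_of_mem_primeFactors ht
    obtain ⟨c, hc, hc1, hwc⟩ := hR.exists_commute_of_semiregular hS.prime hsr hoa
      (hcyc _ (hS.conj_mem w hw a ha)) (w := w) (by
        intro i hi hcomm
        have h1 := mem_zpowers_swap hpw (pow_orderOf_eq_one w) hi (Subgroup.npow_mem_zpowers w i)
        obtain ⟨n, hn⟩ := h1
        have h2 : Commute w a := by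
          rw [← show (w ^ i) ^ n = w from hn]
          exact hcomm.zpow_left n
        exact hts (by rw [← how, ← hoa]; exact hcon w a h2 hpw (hoa ▸ hS.prime)))
      (by
        intro hall
        obtain ⟨c, hc, hc1⟩ := hR.exists_ne_one
        exact hfix a c (hoa ▸ hS.prime) (hoa ▸ hsr) hc hc1 (hall c hc))
    exact hfix w c hpw (ne_of_orderOf_mem hrM hw) hc hc1 hwc

/-- Automorphisms of a cyclic group are power maps, so they commute. -/
lemma commute_commutator_of_normalize {G : Type*} [Group G] {a b n : G}
    (ha : a * n * a⁻¹ ∈ Subgroup.zpowers n) (hb : b * n * b⁻¹ ∈ Subgroup.zpowers n) :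
    Commute ((b * a)⁻¹ * (a * b)) n := by
  obtain ⟨i, hi⟩ := Subgroup.mem_zpowers_iff.1 ha
  obtain ⟨j, hj⟩ := Subgroup.mem_zpowers_iff.1 hb
  have h1 : ∀ x y : G, ∀ i j : ℤ, n ^ i = x * n * x⁻¹ → n ^ j = y * n * y⁻¹ →
      (x * y) * n * (x * y)⁻¹ = n ^ (i * j) := by
    intro x y i j hi hj
    calc (x * y) * n * (x * y)⁻¹ = x * (y * n * y⁻¹) * x⁻¹ := by group
      _ = _ := by rw [← hj, ← conj_zpow, ← hi, zpow_mul]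
  have h2 : (a * b) * n * (a * b)⁻¹ = (b * a) * n * (b * a)⁻¹ := by
    rw [h1 a b i j hi hj, h1 b a j i hj hi, mul_comm]
  have h3 : (a * b) * n = (b * a) * n * (b * a)⁻¹ * (a * b) := mul_inv_eq_iff_eq_mul.1 h2
  change (b * a)⁻¹ * (a * b) * n = n * ((b * a)⁻¹ * (a * b))
  rw [mul_assoc, h3]
  group

lemma commute_of_inv_mul_eq_one {G : Type*} [Group G] {a b : G}
    (h : (b * a)⁻¹ * (a * b) = 1) : Commute a b := (inv_mul_eq_one.1 h).symm

/-- A group normalizing commuting subgroups of two coprime prime orders is commutative. -/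
lemma ClawFree.commute_of_normalize (h : ClawFree (reducedPowerGraph G)) {J : Subgroup G} {x y : G}
    (hxy : Commute x y) (hx : (orderOf x).Prime) (hy : (orderOf y).Prime)
    (hne : orderOf x ≠ orderOf y) (hxJ : ¬ orderOf x ∣ Nat.card J) (hyJ : ¬ orderOf y ∣ Nat.card J)
    (hJx : ∀ a ∈ J, a * x * a⁻¹ ∈ Subgroup.zpowers x)
    (hJy : ∀ a ∈ J, a * y * a⁻¹ ∈ Subgroup.zpowers y) {a b : G} (ha : a ∈ J) (hb : b ∈ J) :
    Commute a b := by
  apply commute_of_inv_mul_eq_one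
  by_contra hk
  have hcx := commute_commutator_of_normalize (hJx a ha) (hJx b hb)
  have hcy := commute_commutator_of_normalize (hJy a ha) (hJy b hb)
  have hkJ : (b * a)⁻¹ * (a * b) ∈ J := mul_mem (inv_mem (mul_mem hb ha)) (mul_mem ha hb)
  set k := (b * a)⁻¹ * (a * b)
  -- A power of the commutator k has prime order and centralizes both x and y, supplying a third
  -- order.
  obtain ⟨r, hr, hrk⟩ := Nat.exists_prime_and_dvd (n := orderOf k)
    (fun h => hk (orderOf_eq_one_iff.1 h))
  have hor : orderOf (k ^ (orderOf k / r)) = r := orderOf_pow_orderOf_div (orderOf_pos k).ne' hrk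
  have hmem := pow_mem hkJ (orderOf k / r)
  exact h.not_three_orders hxy (hcx.symm.pow_right _) (hcy.symm.pow_right (orderOf k / r)) hx hy
    (hor.symm ▸ hr) hne (ne_of_orderOf_mem hxJ hmem).symm (ne_of_orderOf_mem hyJ hmem).symm

lemma ClawFree.not_commutative_of_three_primes (h : ClawFree (reducedPowerGraph G))
    {J : Subgroup G} (hJ : 3 ≤ (Nat.card J).primeFactors.card)
    (hcomm : ∀ a ∈ J, ∀ b ∈ J, Commute a b) : False := by
  obtain ⟨r, hr, s, hs, t, ht, hrs, hrt, hst⟩ := Finset.two_lt_card.1 hJ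
  obtain ⟨a, ha, rfl⟩ := exists_mem_orderOf_eq (Nat.prime_of_mem_primeFactors hr)
    (Nat.dvd_of_mem_primeFactors hr)
  obtain ⟨b, hb, rfl⟩ := exists_mem_orderOf_eq (Nat.prime_of_mem_primeFactors hs)
    (Nat.dvd_of_mem_primeFactors hs)
  obtain ⟨c, hc, rfl⟩ := exists_mem_orderOf_eq (Nat.prime_of_mem_primeFactors ht)
    (Nat.dvd_of_mem_primeFactors ht)
  exact h.not_three_orders (hcomm a ha b hb) (hcomm a ha c hc) (hcomm b hb c hc)
    (Nat.prime_of_mem_primeFactors hr) (Nat.prime_of_mem_primeFactors hs)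
    (Nat.prime_of_mem_primeFactors ht) hrs hrt hst

/-- Commuting invariant elementary abelian subgroups of distinct characteristics are cyclic. -/
lemma ClawFree.le_zpowers_of_commute (h : ClawFree (reducedPowerGraph G)) {K L P Q : Subgroup G}
    {p q : ℕ} (hP : IsInvariantElementary K P p) (hQ : IsInvariantElementary L Q q) (hpq : p ≠ q)
    {x y : G} (hx : x ∈ P) (hx1 : x ≠ 1) (hy : y ∈ Q) (hy1 : y ≠ 1)
    (hxQ : ∀ z ∈ Q, Commute x z) : Q ≤ Subgroup.zpowers y := fun z hz =>
  have hox := hP.orderOf_eq hx hx1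
  h.mem_zpowers_of_commute hQ.prime (hox ▸ hP.prime) (hox ▸ hpq) (hQ.pow_eq_one y hy)
    (hQ.pow_eq_one z hz) hy1 (hQ.commute y hy z hz) (hxQ y hy) (hxQ z hz)

lemma commute_of_pow_commute {G : Type*} [Group G] {w y : G} (hw : (orderOf w).Prime) {i : ℕ}
    (hi : w ^ i ≠ 1) (h : Commute (w ^ i) y) : Commute w y := by
  obtain ⟨n, hn⟩ := Subgroup.mem_zpowers_iff.1
    (mem_zpowers_swap hw (pow_orderOf_eq_one w) hi (Subgroup.npow_mem_zpowers w i))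
  rw [← hn]
  exact h.zpow_left n

/-- The configuration in which a `p`-complement `K` acting on `N` has, inside a `q`-complement,
a subgroup of order `r` centralizing a normal subgroup of order `q`. -/
lemma ClawFree.false_of_commuting_pair (h : ClawFree (reducedPowerGraph G)) {N M : Subgroup G}
    {p : ℕ} (hN : IsInvariantElementary ⊤ N p) {x y : G} (hxy : Commute x y)
    (hx : (orderOf x).Prime) (hy : (orderOf y).Prime) (hne : orderOf x ≠ orderOf y)
    (hxp : orderOf x ≠ p) (hyp : orderOf y ≠ p)
    (hxN : ¬ ∀ c ∈ N, Commute x c) (hyN : ¬ ∀ c ∈ N, Commute y c)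
    (hxM : ¬ orderOf x ∣ Nat.card M) (hyM : ¬ orderOf y ∣ Nat.card M) (hpM : ¬ p ∣ Nat.card M)
    (hMx : ∀ a ∈ M, a * x * a⁻¹ ∈ Subgroup.zpowers x)
    (hMy : ∀ a ∈ M, a * y * a⁻¹ ∈ Subgroup.zpowers y)
    (hM : 2 ≤ (Nat.card M).primeFactors.card) : False := by
  obtain ⟨s, hs, t, ht, hst⟩ := Finset.one_lt_card.1 hM
  have hs' := Nat.prime_of_mem_primeFactors hs
  have ht' := Nat.prime_of_mem_primeFactors ht
  obtain ⟨u, hu, rfl⟩ := exists_mem_orderOf_eq hs' (Nat.dvd_of_mem_primeFactors hs)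
  obtain ⟨v, hv, rfl⟩ := exists_mem_orderOf_eq ht' (Nat.dvd_of_mem_primeFactors ht)
  have huv : Commute u v := h.commute_of_normalize hxy hx hy hne hxM hyM hMx hMy hu hv
  have hord : ∀ c ∈ N, c ≠ 1 → orderOf c = p := fun c hc hc1 => hN.orderOf_eq hc hc1
  have hfaith : ∀ w ∈ M, (orderOf w).Prime → ¬ (Commute w x ∧ Commute w y) := fun w hw hwp hc =>
    h.not_three_orders hc.1 hc.2 hxy hwp hx hy (ne_of_orderOf_mem hxM hw)
      (ne_of_orderOf_mem hyM hw) hne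
  have single : ∀ z : G, (orderOf z).Prime → orderOf z ≠ p → (¬ ∀ c ∈ N, Commute z c) →
      ∀ w ∈ M, (orderOf w).Prime → w * z * w⁻¹ ∈ Subgroup.zpowers z → ¬ Commute w z →
      ∃ c ∈ N, c ≠ 1 ∧ Commute w c := fun z hz hzp hzN w _ hwp hwz hncomm =>
    hN.exists_commute_of_semiregular hz hzp rfl hwz
      (fun i hi hc => hncomm (commute_of_pow_commute hwp hi hc)) hzN
  -- If neither u nor v centralizes z, then uv acts semiregularly on ⟨z⟩; its fixed point in N
  -- commutes with u and v.
  have both : ∀ z : G, (orderOf z).Prime → orderOf z ≠ p → (¬ ∀ c ∈ N, Commute z c) →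
      (∀ a ∈ M, a * z * a⁻¹ ∈ Subgroup.zpowers z) → ¬ Commute u z → ¬ Commute v z → False := by
    intro z hz hzp hzN hMz huz hvz
    have hcop := (Nat.coprime_primes hs' ht').2 hst
    obtain ⟨c, hc, hc1, hwc⟩ := hN.exists_commute_of_semiregular hz hzp rfl (w := u * v)
      (hMz _ (mul_mem hu hv)) (by
        intro i hi hcomm
        by_cases h1 : u ^ i = 1
        · rw [huv.mul_pow, h1, one_mul] at hi hcomm
          exact hvz (commute_of_pow_commute ht' hi hcomm)
        · have h2 : u ^ (i * orderOf v) ≠ 1 := by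
            change ¬ u ^ (i * orderOf v) = 1
            rw [← orderOf_dvd_iff_pow_eq_one] at h1 ⊢
            exact fun hd => h1 (hcop.dvd_of_dvd_mul_right hd)
          refine huz (commute_of_pow_commute hs' h2 ?_)
          have h3 := hcomm.pow_left (orderOf v)
          rwa [← pow_mul, huv.mul_pow, mul_comm i, pow_mul v, pow_orderOf_eq_one, one_pow, mul_one,
            mul_comm (orderOf v)] at h3) hzN
    obtain ⟨m, hm⟩ := Subgroup.mem_zpowers_iff.1 (huv.left_mem_zpowers_mul hcop)
    obtain ⟨n, hn⟩ := Subgroup.mem_zpowers_iff.1 (huv.symm.left_mem_zpowers_mul hcop.symm)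
    have huc : Commute u c := by
      rw [← hm]
      exact hwc.zpow_left m
    have hvc : Commute v c := by
      rw [← hn, ← huv.eq]
      exact hwc.zpow_left n
    have hoc := hord c hc hc1
    exact h.not_three_orders huc.symm hvc.symm huv (hoc ▸ hN.prime) hs' ht'
      (hoc ▸ (ne_of_orderOf_mem hpM hu).symm) (hoc ▸ (ne_of_orderOf_mem hpM hv).symm) hst
  -- If u centralizes z' but not z, it commutes with v, with z' and with a fixed point in N: three
  -- further prime orders.
  have mixed : ∀ z z' : G, (orderOf z).Prime → orderOf z ≠ p → (¬ ∀ c ∈ N, Commute z c) →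
      (∀ a ∈ M, a * z * a⁻¹ ∈ Subgroup.zpowers z) → ¬ orderOf z ∣ Nat.card M →
      (orderOf z').Prime → orderOf z' ≠ p → ¬ orderOf z' ∣ Nat.card M →
      ¬ Commute u z → Commute u z' → False := by
    intro z z' hz hzp hzN hMz hzM hz' hz'p hz'M huz huz'
    obtain ⟨c, hc, hc1, huc⟩ := single z hz hzp hzN u hu hs' (hMz u hu) huz
    have hoc := hord c hc hc1
    exact h.not_three_neighbors huv huz' huc hs' ht' hz' (hoc ▸ hN.prime) hst
      (ne_of_orderOf_mem hz'M hu) (hoc ▸ ne_of_orderOf_mem hpM hu) (ne_of_orderOf_mem hz'M hv)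
      (hoc ▸ ne_of_orderOf_mem hpM hv) (hoc ▸ hz'p)
  by_cases hux : Commute u x
  · exact mixed y x hy hyp hyN hMy hyM hx hxp hxM (fun hc => hfaith u hu hs' ⟨hux, hc⟩) hux
  by_cases huy : Commute u y
  · exact mixed x y hx hxp hxN hMx hxM hy hyp hyM hux huy
  by_cases hvx : Commute v x
  · exact both y hy hyp hyN hMy huy (fun hc => hfaith v hv ht' ⟨hvx, hc⟩)
  · exact both x hx hxp hxN hMx hux hvx

/-- The configuration of a faithful tower `J` on `Q` on `N`. -/
lemma ClawFree.false_of_faithful_tower [Group.IsSolvable G] (h : ClawFree (reducedPowerGraph G))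
    {N Q J : Subgroup G} {p q : ℕ} (hN : IsInvariantElementary ⊤ N p)
    (hQ : IsInvariantElementary J Q q) (hqp : q ≠ p) (hpJ : ¬ p ∣ Nat.card J)
    (hQN : ∀ x ∈ Q, (∀ c ∈ N, Commute x c) → x = 1)
    (hJQ : ∀ l ∈ J, (∀ x ∈ Q, Commute l x) → l = 1)
    (hJ : 3 ≤ (Nat.card J).primeFactors.card) : False := by
  obtain ⟨a, ha, ha1⟩ := hQ.exists_ne_one
  by_cases hcyc : ∃ b ∈ Q, b ∉ Subgroup.zpowers a
  swap
  · push Not at hcyc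
    -- With Q cyclic, J embeds in the abelian group of its automorphisms.
    refine h.not_commutative_of_three_primes hJ fun l hl m hm => commute_of_inv_mul_eq_one
      (hJQ _ (mul_mem (inv_mem (mul_mem hm hl)) (mul_mem hl hm)) fun x hx => ?_)
    obtain ⟨n, hn⟩ := Subgroup.mem_zpowers_iff.1 (hcyc x hx)
    rw [← hn]
    exact (commute_commutator_of_normalize (hcyc _ (hQ.conj_mem l hl a ha))
      (hcyc _ (hQ.conj_mem m hm a ha))).zpow_right n
  obtain ⟨b, hb, hba⟩ := hcyc
  have hnorm : N.Normal := ⟨fun x hx k => hN.conj_mem k trivial x hx⟩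
  let _ : CommGroup N :=
    { (inferInstance : Group N) with
      mul_comm := fun x y => Subtype.ext (hN.commute x x.2 y y.2) }
  have hiff : ∀ (g : G) (v : N), MulAut.conjNormal g v = v ↔ Commute g v := by
    intro g v
    rw [Subtype.ext_iff, MulAut.conjNormal_apply]
    exact mul_inv_eq_iff_eq_mul
  have hfix : ∀ l ∈ J, ∃ c ∈ N, c ≠ 1 ∧ Commute l c := by
    intro l hl
    obtain ⟨v, hv1, hv⟩ := exists_fixedPoint_of_lines (MulAut.conjNormal (H := N)) hQ.prime Q J
      hQ.conj_mem hQ.commute hQ.pow_eq_one hJQ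
      (fun x hx hall => hQN x hx fun c hc => (hiff x ⟨c, hc⟩).1 (hall ⟨c, hc⟩))
      (fun v hv => Subtype.ext (hN.eq_one_of_pow_eq_one hQ.prime hqp v.2
        (congrArg Subtype.val hv)))
      (fun v hv1 x hx y hy hx1 hxv hyv => by
        have hov := hN.orderOf_eq v.2 (fun h => hv1 (Subtype.ext h))
        exact h.mem_zpowers_of_commute hQ.prime (z := v) (hov ▸ hN.prime) (hov ▸ hqp.symm)
          (hQ.pow_eq_one x hx) (hQ.pow_eq_one y hy) hx1 (hQ.commute x hx y hy)
          ((hiff x v).1 hxv).symm ((hiff y v).1 hyv).symm)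
      (fun x hx hx1 v w hv1 hxv hxw => by
        have hox := hQ.orderOf_eq hx hx1
        have hm := h.mem_zpowers_of_commute hN.prime (z := x) (hox ▸ hQ.prime) (hox ▸ hqp)
          (hN.pow_eq_one v v.2) (hN.pow_eq_one w w.2) (fun h => hv1 (Subtype.ext h))
          (hN.commute v v.2 w w.2) ((hiff x v).1 hxv) ((hiff x w).1 hxw)
        obtain ⟨n, hn⟩ := Subgroup.mem_zpowers_iff.1 hm
        exact Subgroup.mem_zpowers_iff.2 ⟨n, Subtype.ext hn⟩)
      ⟨a, ha, b, hb, ha1, hba⟩ hl (isOfFinOrder_of_finite l)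
    exact ⟨v, v.2, fun h => hv1 (Subtype.ext h), (hiff l v).1 hv⟩
  -- A fixed point of uv in N is fixed by u and v separately, which gives three commuting prime
  -- orders.
  obtain ⟨u, v, huv, hu, hv, hne⟩ := exists_commute_of_three_primes J hJ
  rw [← Subgroup.orderOf_coe] at hu hv hne
  rw [← Subgroup.orderOf_coe v] at hne
  have huv' : Commute (u : G) (v : G) := huv.map J.subtype
  have hcop := (Nat.coprime_primes hu hv).2 hne
  obtain ⟨c, hc, hc1, hlc⟩ := hfix _ (mul_mem u.2 v.2)
  obtain ⟨m, hm⟩ := Subgroup.mem_zpowers_iff.1 (huv'.left_mem_zpowers_mul hcop)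
  obtain ⟨n, hn⟩ := Subgroup.mem_zpowers_iff.1 (huv'.symm.left_mem_zpowers_mul hcop.symm)
  have huc : Commute (u : G) c := by
    rw [← hm]
    exact hlc.zpow_left m
  have hvc : Commute (v : G) c := by
    rw [← hn, ← huv'.eq]
    exact hlc.zpow_left n
  have hoc := hN.orderOf_eq hc hc1
  exact h.not_three_orders huv' huc hvc hu hv (hoc ▸ hN.prime) hne
    (hoc ▸ ne_of_orderOf_mem hpJ u.2) (hoc ▸ ne_of_orderOf_mem hpJ v.2)

lemma conj_mem_inf_centralizer {G : Type*} [Group G] {K N : Subgroup G}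
    (hKN : ∀ k ∈ K, ∀ x ∈ N, k * x * k⁻¹ ∈ N) {k : G} (hk : k ∈ K) {x : G}
    (hx : x ∈ K ⊓ Subgroup.centralizer N) : k * x * k⁻¹ ∈ K ⊓ Subgroup.centralizer N := by
  refine Subgroup.mem_inf.2 ⟨mul_mem (mul_mem hk hx.1) (inv_mem hk),
    Subgroup.mem_centralizer_iff.2 fun n hn => ?_⟩
  have h1 := Subgroup.mem_centralizer_iff.1 hx.2 _ (hKN _ (inv_mem hk) n hn)
  rw [inv_inv] at h1
  calc n * (k * x * k⁻¹) = k * ((k⁻¹ * n * k) * x) * k⁻¹ := by group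
    _ = _ := by rw [h1]; group

/-- The kernel of the action of K on N is K-invariant, so an invariant elementary subgroup can be
chosen inside it. -/
lemma exists_invariantElementary_commute [Group.IsSolvable G] {K N : Subgroup G}
    (hKN : ∀ k ∈ K, ∀ x ∈ N, k * x * k⁻¹ ∈ N)
    (h : ∃ x ∈ K, x ≠ 1 ∧ ∀ c ∈ N, Commute x c) :
    ∃ q, ∃ Q ≤ K, IsInvariantElementary K Q q ∧ ∀ x ∈ Q, ∀ c ∈ N, Commute x c := by
  obtain ⟨x, hx, hx1, hxN⟩ := h
  obtain ⟨q, Q, hQ, hKQ⟩ := exists_invariantElementary_le (K := K)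
    (M := K ⊓ Subgroup.centralizer N) inf_le_left
    ⟨x, ⟨hx, Subgroup.mem_centralizer_iff.2 fun n hn => (hxN n hn).symm⟩, hx1⟩
    (fun k hk x hx => conj_mem_inf_centralizer hKN hk hx)
  exact ⟨q, Q, fun x hx => (hQ hx).1, hKQ, fun x hx c hc =>
    (Subgroup.mem_centralizer_iff.1 (hQ hx).2 c hc).symm⟩

theorem ClawFree.numPrimeDivisors_le_four [Group.IsSolvable G]
    (h : ClawFree (reducedPowerGraph G)) : numPrimeDivisors G ≤ 4 := by
  by_contra hcard
  rw [numPrimeDivisors, not_le] at hcard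
  have htop : (⊤ : Subgroup G) ≠ ⊥ := by
    intro h1
    rw [← Subgroup.card_eq_one, Subgroup.card_top] at h1
    simp [h1] at hcard
  obtain ⟨p, N, -, hN⟩ := exists_normal_elementary_le (⊤ : Subgroup G) htop
  obtain ⟨K, -, hpK, hK⟩ := exists_pComplement_le hN.prime (⊤ : Subgroup G)
  rw [Subgroup.card_top] at hK
  obtain ⟨n, hn, hn1⟩ := hN.exists_ne_one
  have hon := hN.orderOf_eq hn hn1
  by_cases hKN : ∃ x ∈ K, x ≠ 1 ∧ ∀ c ∈ N, Commute x c
  · obtain ⟨q, Q, hQK, hQ, hQN⟩ :=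
      exists_invariantElementary_commute (fun k _ => hN.conj_mem k trivial) hKN
    obtain ⟨x, hx, hx1⟩ := hQ.exists_ne_one
    have hox := hQ.orderOf_eq hx hx1
    have hqp : q ≠ p := hox ▸ ne_of_orderOf_mem hpK (hQK hx)
    obtain ⟨J, hJK, hqJ, hJ⟩ := exists_pComplement_le hQ.prime K
    -- Since N and Q centralize each other, both are cyclic of prime order, and J normalizes both.
    have hNn := h.le_zpowers_of_commute hQ hN hqp hx hx1 hn hn1 (hQN x hx)
    have hQx := h.le_zpowers_of_commute hN hQ hqp.symm hn hn1 hx hx1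
      (fun z hz => (hQN z hz n hn).symm)
    refine h.not_commutative_of_three_primes (J := J) (by omega) fun a ha b hb =>
      h.commute_of_normalize (hQN x hx n hn) (hox ▸ hQ.prime) (hon ▸ hN.prime)
        (by rwa [hox, hon]) (hox ▸ hqJ)
        (hon ▸ fun hd => hpK (hd.trans (Subgroup.card_dvd_of_le hJK)))
        (fun k hk => hQx (hQ.conj_mem k (hJK hk) x hx))
        (fun k _ => hNn (hN.conj_mem k trivial n hn)) ha hb
  have hKN' : ∀ x ∈ K, (∀ c ∈ N, Commute x c) → x = 1 := fun x hx hc =>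
    by_contra fun hx1 => hKN ⟨x, hx, hx1, hc⟩
  have hK1 : ∃ x ∈ K, x ≠ 1 := by
    by_contra h1
    push Not at h1
    have h2 : K = ⊥ := (Subgroup.eq_bot_iff_forall K).2 h1
    rw [h2] at hK
    simp at hK
    omega
  obtain ⟨q, Q, hQK, hQ⟩ := exists_invariantElementary_le le_rfl hK1
    (fun k hk x hx => mul_mem (mul_mem hk hx) (inv_mem hk))
  obtain ⟨y, hy, hy1⟩ := hQ.exists_ne_one
  have hoy := hQ.orderOf_eq hy hy1
  have hqp : q ≠ p := hoy ▸ ne_of_orderOf_mem hpK (hQK hy)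
  obtain ⟨J, hJK, hqJ, hJ⟩ := exists_pComplement_le hQ.prime K
  have hpJ : ¬ p ∣ Nat.card J := fun hd => hpK (hd.trans (Subgroup.card_dvd_of_le hJK))
  by_cases hJQ : ∃ x ∈ J, x ≠ 1 ∧ ∀ c ∈ Q, Commute x c
  · obtain ⟨r, R, hRJ, hR, hRQ⟩ :=
      exists_invariantElementary_commute (fun k hk => hQ.conj_mem k (hJK hk)) hJQ
    obtain ⟨x, hx, hx1⟩ := hR.exists_ne_one
    have hox := hR.orderOf_eq hx hx1
    have hrq : r ≠ q := hox ▸ ne_of_orderOf_mem hqJ (hRJ hx)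
    have hrp : r ≠ p := hox ▸ ne_of_orderOf_mem hpJ (hRJ hx)
    obtain ⟨M, hMJ, hrM, hM⟩ := exists_pComplement_le hR.prime J
    -- Here Q and R have prime order and commute; M still has two prime divisors and normalizes
    -- both.
    have hQy := h.le_zpowers_of_commute hR hQ hrq hx hx1 hy hy1 (hRQ x hx)
    have hRx := h.le_zpowers_of_commute hQ hR hrq.symm hy hy1 hx hx1
      (fun z hz => (hRQ z hz y hy).symm)
    exact h.false_of_commuting_pair (M := M) hN (hRQ x hx y hy) (hox ▸ hR.prime) (hoy ▸ hQ.prime)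
      (by rwa [hox, hoy]) (by rwa [hox]) (by rwa [hoy])
      (fun hc => hx1 (hKN' x (hJK (hRJ hx)) hc)) (fun hc => hy1 (hKN' y (hQK hy) hc))
      (by rwa [hox]) (hoy ▸ fun hd => hqJ (hd.trans (Subgroup.card_dvd_of_le hMJ)))
      (fun hd => hpJ (hd.trans (Subgroup.card_dvd_of_le hMJ)))
      (fun k hk => hRx (hR.conj_mem k (hMJ hk) x hx))
      (fun k hk => hQy (hQ.conj_mem k (hJK (hMJ hk)) y hy)) (by omega)
  · exact h.false_of_faithful_tower hN (hQ.mono hJK) hqp hpJ (fun x hx => hKN' x (hQK hx))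
      (fun l hl hc => by_contra fun hl1 => hJQ ⟨l, hl, hl1, hc⟩) (by omega)

end Bound

/-! ### The extremal example. -/

section Example

lemma card_cyc (n : ℕ) : Nat.card (Cyc n) = n := Nat.card_zmod n

/-- Semidirect products of cyclic groups of orders `p * q` and `r * s` with fixed-point-free action
have claw-free reduced power graph. -/
lemma clawFree_semidirectProduct {N K : Type*} [CommGroup N] [CommGroup K] [Finite N] [Finite K]
    [IsCyclic N] [IsCyclic K] {p q r s : ℕ} (hp : p.Prime) (hq : q.Prime) (hr : r.Prime)
    (hs : s.Prime) (hN : Nat.card N = p * q) (hK : Nat.card K = r * s) (φ : K →* MulAut N)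
    [Finite (N ⋊[φ] K)] (hφ : ∀ k n, φ k n = n → k = 1 ∨ n = 1) :
    ClawFree (reducedPowerGraph (N ⋊[φ] K)) := by
  refine clawFree_of_centralizer fun c hc => ?_
  -- The centralizer of c lies in N if c does; otherwise it meets N trivially and projects
  -- injectively to K.
  by_cases hk : c.right = 1
  · have hn : c.left ≠ 1 := fun h => hc (SemidirectProduct.ext h hk)
    have hle : Subgroup.centralizer {c} ≤ (SemidirectProduct.inl : N →* N ⋊[φ] K).range := by
      intro g hg
      rw [Subgroup.mem_centralizer_singleton_iff] at hg
      have h1 := congrArg SemidirectProduct.left hg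
      rw [SemidirectProduct.mul_left, SemidirectProduct.mul_left, hk, map_one, MulAut.one_apply,
        mul_comm c.left] at h1
      rw [SemidirectProduct.range_inl_eq_ker_rightHom, MonoidHom.mem_ker]
      exact (hφ _ _ (mul_left_cancel h1)).resolve_right hn
    have hcyc : IsCyclic (SemidirectProduct.inl : N →* N ⋊[φ] K).range :=
      isCyclic_of_surjective (SemidirectProduct.inl : N →* N ⋊[φ] K).rangeRestrict
        (MonoidHom.rangeRestrict_surjective _)
    refine ⟨p, q, hp, hq, isCyclic_of_injective (Subgroup.inclusion hle)
      (Subgroup.inclusion_injective hle), (Subgroup.card_dvd_of_le hle).trans ?_⟩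
    rw [← hN, ← Nat.card_congr
      (MonoidHom.ofInjective (SemidirectProduct.inl_injective (φ := φ))).toEquiv]
  · have hinj : Function.Injective
        ((SemidirectProduct.rightHom (φ := φ)).comp (Subgroup.centralizer {c}).subtype) := by
      rw [injective_iff_map_eq_one]
      rintro ⟨g, hg⟩ hg1
      replace hg1 : g.right = 1 := hg1
      rw [Subgroup.mem_centralizer_singleton_iff] at hg
      have h1 := congrArg SemidirectProduct.left hg
      rw [SemidirectProduct.mul_left, SemidirectProduct.mul_left, hg1, map_one, MulAut.one_apply,
        mul_comm g.left] at h1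
      have h2 := (hφ _ _ (mul_left_cancel h1).symm).resolve_left hk
      exact Subtype.ext (SemidirectProduct.ext h2 hg1)
    exact ⟨r, s, hr, hs, isCyclic_of_injective _ hinj, hK ▸ Subgroup.card_dvd_of_injective _ hinj⟩

lemma MulAut.eq_one_of_apply_eq {C : Type*} [Group C] {p : ℕ} (hp : p.Prime) (hC : Nat.card C = p)
    {α : MulAut C} {x : C} (hx : x ≠ 1) (h : α x = x) : α = 1 := by
  have := Fact.mk hp
  ext y
  obtain ⟨n, rfl⟩ := Subgroup.mem_zpowers_iff.1 (mem_zpowers_of_prime_card hC hx (g' := y))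
  rw [map_zpow, h, MulAut.one_apply]

/-- The automorphism group is the unit group of `ZMod p`, which is cyclic of order p - 1. -/
lemma exists_orderOf_mulAut_eq {p n : ℕ} (hp : p.Prime) (hn : n ∣ p - 1) :
    ∃ α : MulAut (Cyc p), orderOf α = n := by
  have := Fact.mk hp
  let e := IsCyclic.mulAutMulEquiv (Cyc p)
  have hc : Nat.card (Cyc p) = p := card_cyc p
  obtain ⟨u, hu⟩ : ∃ u : (ZMod (Nat.card (Cyc p)))ˣ, orderOf u = n := by
    rw [hc]
    obtain ⟨g, hg⟩ := IsCyclic.exists_ofOrder_eq_natCard (α := (ZMod p)ˣ)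
    rw [Nat.card_eq_fintype_card, ZMod.card_units] at hg
    exact ⟨g ^ (orderOf g / n), orderOf_pow_orderOf_div (orderOf_pos g).ne' (hg ▸ hn)⟩
  exact ⟨e.symm u, by rw [MulEquiv.orderOf_eq, hu]⟩

lemma exists_hom_ofAdd_one {M : Type*} [Group M] {n : ℕ} {β : M} (h : β ^ n = 1) :
    ∃ φ : Cyc n →* M, φ (Multiplicative.ofAdd 1) = β := by
  let f : ZMod n →+ Additive M := ZMod.lift n ⟨zmultiplesHom (Additive M) (Additive.ofMul β), by
    rw [zmultiplesHom_apply, ← ofMul_zpow, zpow_natCast, h, ofMul_one]⟩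
  refine ⟨AddMonoidHom.toMultiplicativeLeft f, ?_⟩
  change Additive.toMul (f 1) = β
  have h1 := ZMod.lift_coe n ⟨zmultiplesHom (Additive M) (Additive.ofMul β), by
    rw [zmultiplesHom_apply, ← ofMul_zpow, zpow_natCast, h, ofMul_one]⟩ 1
  rw [Int.cast_one] at h1
  simp only [f, h1]
  simp

lemma prodCongr_pow_apply {A B : Type*} [Group A] [Group B] (α : MulAut A) (β : MulAut B) (i : ℕ)
    (x : A × B) : ((MulEquiv.prodCongr α β : MulAut (A × B)) ^ i) x = ((α ^ i) x.1, (β ^ i) x.2) := by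
  induction i with
  | zero => simp
  | succ k ih =>
    rw [pow_succ', MulAut.mul_apply, ih, pow_succ', pow_succ']
    rfl

/-- On a group of prime order an automorphism fixing a nontrivial element is trivial. As both
components have full order n, a power of the generator with a nontrivial fixed point is 1. -/
lemma fixedPointFree_prodCongr {p q n : ℕ} (hp : p.Prime) (hq : q.Prime) [NeZero n]
    {α : MulAut (Cyc p)} {β : MulAut (Cyc q)} (hα : orderOf α = n) (hβ : orderOf β = n)
    {φ : Cyc n →* MulAut (Cyc p × Cyc q)}
    (hφ : φ (Multiplicative.ofAdd 1) = MulEquiv.prodCongr α β) (k : Cyc n) (x : Cyc p × Cyc q)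
    (h : φ k x = x) : k = 1 ∨ x = 1 := by
  obtain ⟨i, rfl⟩ : ∃ i : ℕ, k = Multiplicative.ofAdd (1 : ZMod n) ^ i :=
    ⟨(Multiplicative.toAdd k).val, by
      rw [← ofAdd_nsmul, nsmul_one, ZMod.natCast_zmod_val, ofAdd_toAdd]⟩
  rw [map_pow, hφ, prodCongr_pow_apply] at h
  have h1 : n ∣ i → Multiplicative.ofAdd (1 : ZMod n) ^ i = 1 := by
    intro hd
    rw [← ofAdd_nsmul, nsmul_one, (ZMod.natCast_eq_zero_iff i n).2 hd, ofAdd_zero]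
  by_cases hx1 : x.1 = 1
  · by_cases hx2 : x.2 = 1
    · exact Or.inr (Prod.ext hx1 hx2)
    · refine Or.inl (h1 ?_)
      rw [← hβ, orderOf_dvd_iff_pow_eq_one]
      exact MulAut.eq_one_of_apply_eq hq (card_cyc q) hx2 (congrArg Prod.snd h)
  · refine Or.inl (h1 ?_)
    rw [← hα, orderOf_dvd_iff_pow_eq_one]
    exact MulAut.eq_one_of_apply_eq hp (card_cyc p) hx1 (congrArg Prod.fst h)

lemma isSolvable_semidirectProduct {N K : Type*} [Group N] [Group K] [Group.IsSolvable N]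
    [Group.IsSolvable K] (φ : K →* MulAut N) : Group.IsSolvable (N ⋊[φ] K) :=
  Group.isSolvable_of_ker_le_range (SemidirectProduct.inl : N →* N ⋊[φ] K)
    SemidirectProduct.rightHom SemidirectProduct.range_inl_eq_ker_rightHom.ge

lemma isCyclic_cyc_prod {p q : ℕ} (h : p.Coprime q) : IsCyclic (Cyc p × Cyc q) :=
  Group.isCyclic_prod_iff.2 ⟨inferInstance, inferInstance, by
    rw [card_cyc, card_cyc]
    exact h⟩

lemma card_cyc_prod (p q : ℕ) : Nat.card (Cyc p × Cyc q) = p * q := by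
  rw [Nat.card_prod, card_cyc, card_cyc]

end Example

theorem mainTheorem4 :
    -- the bound
    (∀ (G : Type*) [Group G] [Finite G] [Group.IsSolvable G],
      ClawFree (reducedPowerGraph G) → numPrimeDivisors G ≤ 4) ∧
    -- the bound is attained by the semidirect products of `C₃₁ × C₆₁` (cyclic of order `31 * 61`)
    -- with `C₁₅`, whose generator acts on both factors by automorphisms of order 15; they exist
    IsCyclic (Cyc 31 × Cyc 61) ∧ Nat.card (Cyc 31 × Cyc 61) = 31 * 61 ∧
    (∃ α₁ : MulAut (Cyc 31), orderOf α₁ = 15) ∧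
    (∃ α₂ : MulAut (Cyc 61), orderOf α₂ = 15) ∧
    ∀ (α₁ : MulAut (Cyc 31)) (α₂ : MulAut (Cyc 61)), orderOf α₁ = 15 → orderOf α₂ = 15 →
      ∃ φ : Cyc 15 →* MulAut (Cyc 31 × Cyc 61),
        φ (Multiplicative.ofAdd 1) = MulEquiv.prodCongr α₁ α₂ ∧
        Finite ((Cyc 31 × Cyc 61) ⋊[φ] Cyc 15) ∧
        Group.IsSolvable ((Cyc 31 × Cyc 61) ⋊[φ] Cyc 15) ∧
        ClawFree (reducedPowerGraph ((Cyc 31 × Cyc 61) ⋊[φ] Cyc 15)) ∧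
        numPrimeDivisors ((Cyc 31 × Cyc 61) ⋊[φ] Cyc 15) = 4 := by
  have h31 : Nat.Prime 31 := by norm_num
  have h61 : Nat.Prime 61 := by norm_num
  have hcyc : IsCyclic (Cyc 31 × Cyc 61) := isCyclic_cyc_prod (by norm_num)
  refine ⟨fun G _ _ _ h => h.numPrimeDivisors_le_four, hcyc, card_cyc_prod 31 61,
    exists_orderOf_mulAut_eq h31 (by norm_num), exists_orderOf_mulAut_eq h61 (by norm_num), ?_⟩
  intro α₁ α₂ h₁ h₂
  obtain ⟨φ, hφ⟩ := exists_hom_ofAdd_one (n := 15)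
    (β := (MulEquiv.prodCongr α₁ α₂ : MulAut (Cyc 31 × Cyc 61))) (by
      ext x : 1
      -- The exponent 15 is read as `orderOf α₁` for the first component, then as `orderOf α₂` for
      -- the second.
      rw [prodCongr_pow_apply, ← h₁, pow_orderOf_eq_one, h₁, ← h₂, pow_orderOf_eq_one]
      rfl)
  have hfin : Finite ((Cyc 31 × Cyc 61) ⋊[φ] Cyc 15) :=
    Finite.of_equiv _ SemidirectProduct.equivProd.symm
  refine ⟨φ, hφ, hfin, isSolvable_semidirectProduct φ,
    clawFree_semidirectProduct h31 h61 Nat.prime_three Nat.prime_five (card_cyc_prod 31 61)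
      (card_cyc 15) φ (fixedPointFree_prodCongr h31 h61 h₁ h₂ hφ), ?_⟩
  rw [numPrimeDivisors, SemidirectProduct.card, card_cyc_prod,
    show Nat.card (Cyc 15) = 3 * 5 from card_cyc 15,
    Nat.primeFactors_mul (by norm_num) (by norm_num),
    Nat.primeFactors_mul (by norm_num) (by norm_num),
    Nat.primeFactors_mul (by norm_num) (by norm_num), h31.primeFactors, h61.primeFactors,
    Nat.prime_three.primeFactors, Nat.prime_five.primeFactors]
  rfl
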